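/- Let $d\ge 1$, and let $(X_t)_{t\ge 0}$ be a standard $d$-dimensional $(\mathcal F_t)$-Brownian motion with $X_0=0$ on a filtered probability space $(\Omega,\mathcal F,(\mathcal F_t)_{t\ge0},P)$. Let $\mathcal S$ be the space of real-valued rapidly decreasing smooth functions on $\mathbb R^d$ and $\mathcal S'$ its dual. For $k\in\mathbb Z_+^d$ let $h_k(x)=h_{k_1}(x_1)\cdots h_{k_d}(x_d)$, where $h_\ell(s)=(\sqrt\pi\,2^\ell\,\ell!)^{-1/2}e^{-s^2/2}H_\ell(s)$ and $H_\ell(s)=(-1)^\ell e^{s^2}\frac{d^\ell}{ds^\ell}e^{-s^2}$. For $p\in\mathbb R$ let $\mathcal S_p\subset\mathcal S'$ be the completion of $\mathcal S$ under $$\|\varphi\|_p^2=\sum_{k}(2|k|+d)^{2p}\langle\varphi,h_k\rangle^2 ,\qquad |k|=k_1+\dots+k_d .$$ For $x\in\mathbb R^d$ let $\tau_x$ be the translation operator on $\mathcal S'$, $\langle\tau_x\varphi,f\rangle=\langle\varphi,\tau_{-x}f\rangle$ with $\tau_{-x}f(y)=f(y+x)$; it maps $\mathcal S_p$ into itself.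 Let $p_t(x)=(2\pi t)^{-d/2}e^{-|x|^2/(2t)}$ for $t>0$, and for $\varphi\in\mathcal S'$ let $\varphi*p_t$ be the distribution given by the function $x\mapsto\langle\varphi,p_t(x-\cdot)\rangle$. Put $T_t\varphi=\varphi*p_t$ for $t>0$ and $T_0\varphi=\varphi$. Theorem 2.4. Let $p\in\mathbb R$. (a) For every $\varphi\in\mathcal S_p$ and $t\ge0$, the $\mathcal S_p$-valued random variable $\tau_{X_t}\varphi$ is Bochner integrable, and $$E\,\tau_{X_t}\varphi=T_t\varphi ,$$ that is, $E\,\tau_{X_t}\varphi=\varphi*p_t$ for $t>0$ and $E\,\tau_{X_0}\varphi=\varphi$. In particular each $T_t$ is a bounded linear operator on $\mathcal S_p$, and for every $T>0$, $\sup_{0\le t\le T}\|T_t\|<\infty$, where $\|T_t\|$ is the operator norm of $T_t:\mathcal S_p\to\mathcal S_p$. (b) Let $\varphi\in\mathcal S_p$ and $T>0$. The initial value problem $$\partial_t\varphi_t=\tfrac12\Delta\varphi_t\quad(0<t\le T),\qquad \varphi_0=\varphi,$$ has a unique $\mathcal S_p$-valued solution, namely $\varphi_t=E\,\tau_{X_t}\varphi$,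 $0\le t\le T$. Here an $\mathcal S_p$-valued solution is a continuous map $t\mapsto\varphi_t$ from $[0,T]$ to $\mathcal S_p$ such that for all $t\in[0,T]$ the equation $$\varphi_t=\varphi+\int_0^t\tfrac12\Delta\varphi_s\,ds$$ holds in $\mathcal S_{p-1}$, with the distributional Laplacian $\Delta$. Further, $\varphi_t\to\varphi$ in the norm of $\mathcal S_p$ as $t\downarrow0$. -/

import Mathlib

open MeasureTheory ProbabilityTheory Filter Topology
open scoped SchwartzMap NNReal ENNReal

noncomputable section

namespace HeatSp

/-- The Euclidean space `ℝ^d`. -/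
abbrev Euc (d : ℕ) : Type := EuclideanSpace ℝ (Fin d)

/-! ### Gaussians are Schwartz functions -/

theorem one_add_pow_mul_exp_le (m : ℕ) {a : ℝ} (ha : 0 < a) {r : ℝ} (hr : 0 ≤ r) :
    (1 + r) ^ m * Real.exp (-a * r ^ 2) ≤ (m.factorial : ℝ) * Real.exp (1 + 1 / (4 * a)) := by
  have h1 : (1 + r) ^ m ≤ (m.factorial : ℝ) * Real.exp (1 + r) := by
    have := Real.pow_div_factorial_le_exp (1 + r) (by positivity) m
    rwa [div_le_iff₀' (by positivity)] at this
  have h2 : 1 + r + -a * r ^ 2 ≤ 1 + 1 / (4 * a) := by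
    have h3 : 0 ≤ a * (r - 1 / (2 * a)) ^ 2 := by positivity
    have h4 : a * (r - 1 / (2 * a)) ^ 2 = a * r ^ 2 - r + 1 / (4 * a) := by
      field_simp
      ring
    linarith
  calc (1 + r) ^ m * Real.exp (-a * r ^ 2)
      ≤ (m.factorial : ℝ) * Real.exp (1 + r) * Real.exp (-a * r ^ 2) := by gcongr
    _ = m.factorial * Real.exp (1 + r + -a * r ^ 2) := by rw [mul_assoc, ← Real.exp_add]
    _ ≤ _ := by gcongr

/-- The Gaussian `x ↦ exp (-a |x|²)`, `a > 0`, as a Schwartz function. -/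
def gaussian (d : ℕ) (a : ℝ) (ha : 0 < a) : 𝓢(Euc d, ℝ) where
  toFun x := Real.exp (-a * ‖x‖ ^ 2)
  smooth' := Real.contDiff_exp.comp (contDiff_const.mul (contDiff_norm_sq ℝ))
  decay' := by
    intro k n
    have hq : (fun x : Euc d => -a * ‖x‖ ^ 2).HasTemperateGrowth := by fun_prop
    obtain ⟨l, C, hC0, hC⟩ := hq.norm_iteratedFDeriv_le_uniform n
    refine ⟨n.factorial * (C + 1) ^ n * (((k + l * n).factorial : ℝ) * Real.exp (1 + 1 / (4 * a))), fun x => ?_⟩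
    have hx : (1 : ℝ) ≤ 1 + ‖x‖ := by linarith [norm_nonneg x]
    have hD : (1 : ℝ) ≤ (C + 1) * (1 + ‖x‖) ^ l := by
      have := one_le_pow₀ hx (n := l)
      nlinarith
    have key := norm_iteratedFDeriv_comp_le (𝕜 := ℝ) (g := Real.exp)
      (f := fun x : Euc d => -a * ‖x‖ ^ 2) (n := n) (N := ((⊤ : ℕ∞) : WithTop ℕ∞)) Real.contDiff_exp hq.1
      (by exact_mod_cast le_top) x (C := Real.exp (-a * ‖x‖ ^ 2)) (D := (C + 1) * (1 + ‖x‖) ^ l)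
      (by
        intro i _
        rw [norm_iteratedFDeriv_eq_norm_iteratedDeriv, iteratedDeriv_eq_iterate,
          Real.iter_deriv_exp, Real.norm_eq_abs, abs_of_pos (Real.exp_pos _)])
      (by
        intro i hi hin
        refine (hC i hin x).trans ?_
        refine le_trans ?_ (le_self_pow₀ hD (by omega))
        gcongr
        linarith)
    calc ‖x‖ ^ k * ‖iteratedFDeriv ℝ n (fun x : Euc d => Real.exp (-a * ‖x‖ ^ 2)) x‖
        ≤ (1 + ‖x‖) ^ k *
          (n.factorial * Real.exp (-a * ‖x‖ ^ 2) * ((C + 1) * (1 + ‖x‖) ^ l) ^ n) := by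
          gcongr
          · linarith
          · exact key
      _ = n.factorial * (C + 1) ^ n * ((1 + ‖x‖) ^ (k + l * n) * Real.exp (-a * ‖x‖ ^ 2)) := by
          rw [mul_pow, ← pow_mul, pow_add]; ring
      _ ≤ _ := by
          refine mul_le_mul_of_nonneg_left ?_ (by positivity)
          exact one_add_pow_mul_exp_le _ ha (norm_nonneg x)

/-! ### Hermite functions -/

/-- The Hermite polynomial `H_ℓ(s) = (-1)^ℓ e^{s²} (d/ds)^ℓ e^{-s²}`. -/
def hermiteH (l : ℕ) (s : ℝ) : ℝ :=
  (-1) ^ l * Real.exp (s ^ 2) * iteratedDeriv l (fun r : ℝ => Real.exp (-r ^ 2)) s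

/-- The one-dimensional Hermite function
`h_ℓ(s) = (√π 2^ℓ ℓ!)^{-1/2} e^{-s²/2} H_ℓ(s)`. -/
def hermite1 (l : ℕ) (s : ℝ) : ℝ :=
  (Real.sqrt (Real.sqrt Real.pi * 2 ^ l * l.factorial))⁻¹ * Real.exp (-s ^ 2 / 2) * hermiteH l s

theorem exists_hermiteH_eq (l : ℕ) : ∃ q : Polynomial ℝ, ∀ s, hermiteH l s = q.eval s := by
  have h : ∀ l : ℕ, ∃ q : Polynomial ℝ, ∀ s : ℝ,
      iteratedDeriv l (fun r : ℝ => Real.exp (-r ^ 2)) s = q.eval s * Real.exp (-s ^ 2) := by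
    intro l
    induction l with
    | zero => exact ⟨1, fun s => by simp⟩
    | succ l ih =>
      obtain ⟨q, hq⟩ := ih
      refine ⟨q.derivative - 2 * Polynomial.X * q, fun s => ?_⟩
      rw [iteratedDeriv_succ, funext hq]
      have h1 : HasDerivAt (fun s : ℝ => Real.exp (-s ^ 2)) (Real.exp (-s ^ 2) * (-(2 * s))) s := by
        have := ((hasDerivAt_pow 2 s).neg).exp
        simpa using this
      refine ((q.hasDerivAt s).mul h1).deriv.trans ?_
      simp
      ring
  obtain ⟨q, hq⟩ := h l
  refine ⟨Polynomial.C ((-1) ^ l) * q, fun s => ?_⟩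
  have : Real.exp (s ^ 2) * Real.exp (-s ^ 2) = 1 := by rw [← Real.exp_add]; simp
  rw [hermiteH, hq, Polynomial.eval_mul, Polynomial.eval_C]
  linear_combination (-1) ^ l * q.eval s * this

/-- The product Hermite function `h_k(x) = h_{k_1}(x_1) ⋯ h_{k_d}(x_d)`. -/
def hermiteFun {d : ℕ} (k : Fin d → ℕ) (x : Euc d) : ℝ := ∏ j, hermite1 (k j) (x j)

theorem hasTemperateGrowth_eval (q : Polynomial ℝ) {d : ℕ} (j : Fin d) :
    (fun x : Euc d => q.eval (x j)).HasTemperateGrowth := by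
  have hj : (fun x : Euc d => x j).HasTemperateGrowth :=
    (EuclideanSpace.proj (𝕜 := ℝ) j).hasTemperateGrowth
  simp only [Polynomial.eval_eq_sum_range]
  exact Function.HasTemperateGrowth.sum fun i _ => by fun_prop

theorem hasTemperateGrowth_prod {d : ℕ} (s : Finset (Fin d)) (f : Fin d → Euc d → ℝ)
    (hf : ∀ j, (f j).HasTemperateGrowth) :
    (fun x => ∏ j ∈ s, f j x).HasTemperateGrowth := by
  classical
  induction s using Finset.induction_on with
  | empty => simp [Function.HasTemperateGrowth.const]
  | insert j s hjs ih =>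
    simp only [Finset.prod_insert hjs]
    exact (hf j).mul ih

theorem exists_schwartz_eq_hermiteFun {d : ℕ} (k : Fin d → ℕ) :
    ∃ g : 𝓢(Euc d, ℝ), ∀ x, g x = hermiteFun k x := by
  choose q hq using exists_hermiteH_eq
  let c : Fin d → ℝ := fun j => (Real.sqrt (Real.sqrt Real.pi * 2 ^ k j * (k j).factorial))⁻¹
  have hP : (fun x : Euc d => ∏ j, c j * (q (k j)).eval (x j)).HasTemperateGrowth :=
    hasTemperateGrowth_prod _ _ fun j =>
      (Function.HasTemperateGrowth.const (c j)).mul (hasTemperateGrowth_eval (q (k j)) j)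
  refine ⟨SchwartzMap.smulLeftCLM ℝ (fun x : Euc d => ∏ j, c j * (q (k j)).eval (x j))
    (gaussian d (1 / 2) (by norm_num)), fun x => ?_⟩
  rw [SchwartzMap.smulLeftCLM_apply_apply hP]
  change _ * Real.exp (-(1 / 2) * ‖x‖ ^ 2) = _
  have : Real.exp (-(1 / 2) * ‖x‖ ^ 2) = ∏ j, Real.exp (-(x j) ^ 2 / 2) := by
    rw [← Real.exp_sum, EuclideanSpace.norm_sq_eq, Finset.mul_sum]
    congr 1
    refine Finset.sum_congr rfl fun j _ => ?_
    rw [Real.norm_eq_abs, sq_abs]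
    ring
  rw [this, ← Finset.prod_mul_distrib, hermiteFun]
  refine Finset.prod_congr rfl fun j _ => ?_
  rw [hermite1, hq]
  simp only [c]
  ring

/-- The Hermite function `h_k` as an element of the Schwartz space. -/
def hermiteS {d : ℕ} (k : Fin d → ℕ) : 𝓢(Euc d, ℝ) where
  toFun := hermiteFun k
  smooth' := by
    obtain ⟨g, hg⟩ := exists_schwartz_eq_hermiteFun k
    rw [← funext hg]
    exact g.smooth'
  decay' := by
    obtain ⟨g, hg⟩ := exists_schwartz_eq_hermiteFun k
    rw [← funext hg]
    exact g.decay'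

@[simp] theorem hermiteS_apply {d : ℕ} (k : Fin d → ℕ) (x : Euc d) :
    hermiteS k x = ∏ j, hermite1 (k j) (x j) := rfl

/-! ### Tempered distributions -/

/-- Real tempered distributions on `ℝ^d`: continuous linear functionals on the (real-valued)
Schwartz space. -/
abbrev TD (d : ℕ) : Type := 𝓢(Euc d, ℝ) →L[ℝ] ℝ

/-- Translation of distributions, `⟨τ_x u, f⟩ = ⟨u, τ_{-x} f⟩`, where `(τ_{-x} f)(y) = f(y + x)`. -/
def translate {d : ℕ} (x : Euc d) (u : TD d) : TD d :=
  u ∘L SchwartzMap.compSubConstCLM ℝ (-x)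

/-- The distributional Laplacian, `⟨Δu, f⟩ = ⟨u, Δf⟩`. -/
def laplacian {d : ℕ} (u : TD d) : TD d :=
  u ∘L LineDeriv.laplacianCLM ℝ (Euc d) 𝓢(Euc d, ℝ)

/-- `u` is the distribution given by the function `g`, i.e. `⟨u, f⟩ = ∫ g(x) f(x) dx`. -/
def IsGivenBy {d : ℕ} (u : TD d) (g : Euc d → ℝ) : Prop :=
  ∀ f : 𝓢(Euc d, ℝ), Integrable (fun x => g x * f x) ∧ u f = ∫ x, g x * f x

/-- The heat kernel `p_t(x) = (2πt)^{-d/2} e^{-|x|²/(2t)}`. -/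
def heatKernel {d : ℕ} (t : ℝ) (x : Euc d) : ℝ :=
  1 / (2 * Real.pi * t) ^ ((d : ℝ) / 2) * Real.exp (-(‖x‖ ^ 2 / (2 * t)))

/-- For `t > 0` and fixed `x`, the function `y ↦ p_t(x - y)` as a Schwartz function. -/
def heatKernelS {d : ℕ} (t : ℝ) (ht : 0 < t) (x : Euc d) : 𝓢(Euc d, ℝ) :=
  (1 / (2 * Real.pi * t) ^ ((d : ℝ) / 2)) •
    SchwartzMap.compSubConstCLM ℝ x (gaussian d (1 / (2 * t)) (by positivity))

theorem heatKernelS_apply {d : ℕ} (t : ℝ) (ht : 0 < t) (x y : Euc d) :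
    heatKernelS t ht x y = heatKernel t (x - y) := by
  change _ * Real.exp (-(1 / (2 * t)) * ‖y - x‖ ^ 2) = _
  rw [heatKernel, norm_sub_rev]
  congr 2
  ring

/-- The convolution of the tempered distribution `u` with the heat kernel, i.e. the function
`(u * p_t)(x) = ⟨u, p_t(x - ·)⟩`. -/
def convHeat {d : ℕ} (u : TD d) (t : ℝ) (ht : 0 < t) (x : Euc d) : ℝ := u (heatKernelS t ht x)

/-! ### The Hermite–Sobolev spaces `𝓢_p` -/

/-- The eigenvalue `2|k| + d` of `|x|² - Δ` for the eigenfunction `h_k`. -/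
def hermiteEig {d : ℕ} (k : Fin d → ℕ) : ℝ := 2 * (∑ j, k j : ℕ) + d

theorem hermiteEig_nonneg {d : ℕ} (k : Fin d → ℕ) : 0 ≤ hermiteEig k := by
  unfold hermiteEig; positivity

theorem hermiteEig_pos {d : ℕ} [NeZero d] (k : Fin d → ℕ) : 0 < hermiteEig k := by
  have : (0 : ℝ) < d := by exact_mod_cast Nat.pos_of_ne_zero (NeZero.ne d)
  unfold hermiteEig; positivity

/-- The coordinates `(2|k| + d)^p ⟨u, h_k⟩` of a tempered distribution `u`. -/
def coord {d : ℕ} (p : ℝ) (u : TD d) (k : Fin d → ℕ) : ℝ := hermiteEig k ^ p * u (hermiteS k)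

theorem coord_sq {d : ℕ} (p : ℝ) (u : TD d) (k : Fin d → ℕ) :
    ‖coord p u k‖ ^ (2 : ℝ≥0∞).toReal = hermiteEig k ^ (2 * p) * u (hermiteS k) ^ 2 := by
  simp only [ENNReal.toReal_ofNat, Real.rpow_two, Real.norm_eq_abs, sq_abs, coord, mul_pow]
  rw [mul_comm 2 p, Real.rpow_mul (hermiteEig_nonneg k), Real.rpow_two]

theorem memlp_coord_iff {d : ℕ} (p : ℝ) (u : TD d) :
    Memℓp (coord p u) 2 ↔
      Summable fun k : Fin d → ℕ => hermiteEig k ^ (2 * p) * u (hermiteS k) ^ 2 := by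
  rw [memℓp_gen_iff (by simp)]
  simp only [coord_sq]

/-- The underlying vector space of `𝓢_p`. The completion of the Schwartz space for the norm
`‖φ‖_p² = ∑_k (2|k| + d)^{2p} ⟨φ, h_k⟩²` consists of the Hermite series `∑_k c_k h_k` with
`∑_k (2|k| + d)^{2p} c_k² < ∞`, which converge weakly in the space of tempered distributions. It is
therefore realised, as usual, as the space of the tempered distributions `u` that are the sum of
their Hermite series, `u = ∑_k ⟨u, h_k⟩ h_k` weakly, and for which
`∑_k (2|k| + d)^{2p} ⟨u, h_k⟩²` is finite. -/
def spSubmodule (d : ℕ) (p : ℝ) : Submodule ℝ (TD d) where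
  carrier := {u |
    (∀ f : 𝓢(Euc d, ℝ),
      HasSum (fun k : Fin d → ℕ => u (hermiteS k) * ∫ x, hermiteS k x * f x) (u f)) ∧
    Summable fun k : Fin d → ℕ => hermiteEig k ^ (2 * p) * u (hermiteS k) ^ 2}
  zero_mem' := by
    refine ⟨fun f => ?_, ?_⟩
    · simp
    · simp
  add_mem' := by
    rintro u v ⟨hu, hu'⟩ ⟨hv, hv'⟩
    refine ⟨fun f => ?_, ?_⟩
    · simpa [add_mul] using (hu f).add (hv f)
    · rw [← memlp_coord_iff] at hu' hv' ⊢
      convert hu'.add hv' using 1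
      funext k
      simp [coord, mul_add]
  smul_mem' := by
    rintro c u ⟨hu, hu'⟩
    refine ⟨fun f => ?_, ?_⟩
    · simpa [mul_assoc] using (hu f).mul_left c
    · refine (hu'.mul_left (c ^ 2)).congr fun k => ?_
      simp only [smul_apply, smul_eq_mul]
      ring

/-- The (Hilbertian) space `𝓢_p` on `ℝ^d`. -/
def Sp (d : ℕ) (p : ℝ) : Type := spSubmodule d p

namespace Sp

variable {d : ℕ} {p : ℝ}

instance : AddCommGroup (Sp d p) := inferInstanceAs (AddCommGroup (spSubmodule d p))

instance : Module ℝ (Sp d p) := inferInstanceAs (Module ℝ (spSubmodule d p))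

/-- The inclusion of `𝓢_p` into the space of tempered distributions. -/
def toTD : Sp d p →ₗ[ℝ] TD d := (spSubmodule d p).subtype

theorem toTD_injective : Function.Injective (toTD : Sp d p → TD d) := Subtype.val_injective

/-- The coordinates of an element of `𝓢_p`, as an element of `ℓ²`. -/
def toLp : Sp d p →ₗ[ℝ] lp (fun _ : Fin d → ℕ => ℝ) 2 where
  toFun u := ⟨coord p (toTD u), (memlp_coord_iff p _).2 u.2.2⟩
  map_add' u v := by
    ext k
    change coord p (toTD (u + v)) k = coord p (toTD u) k + coord p (toTD v) k
    simp [coord, mul_add]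
  map_smul' c u := by
    ext k
    simp [coord]
    ring

theorem toLp_injective [NeZero d] : Function.Injective (toLp : Sp d p →ₗ[ℝ] _) := by
  rw [← LinearMap.ker_eq_bot, LinearMap.ker_eq_bot']
  intro u hu
  have h0 : ∀ k : Fin d → ℕ, toTD u (hermiteS k) = 0 := by
    intro k
    have h1 : coord p (toTD u) k = 0 := congrFun (congrArg Subtype.val hu) k
    rcases mul_eq_zero.1 h1 with h | h
    · exact absurd h (Real.rpow_pos_of_pos (hermiteEig_pos k) p).ne'
    · exact h
  apply toTD_injective
  rw [map_zero]
  ext f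
  have h2 : HasSum (fun k : Fin d → ℕ => toTD u (hermiteS k) * ∫ x, hermiteS k x * f x)
    (toTD u f) := u.2.1 f
  simp only [h0, zero_mul] at h2
  exact h2.unique hasSum_zero

instance [NeZero d] : NormedAddCommGroup (Sp d p) :=
  NormedAddCommGroup.induced _ _ (toLp : Sp d p →ₗ[ℝ] lp (fun _ : Fin d → ℕ => ℝ) 2)
    toLp_injective

instance [NeZero d] : NormedSpace ℝ (Sp d p) :=
  NormedSpace.induced ℝ (Sp d p) _ (toLp : Sp d p →ₗ[ℝ] lp (fun _ : Fin d → ℕ => ℝ) 2)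

/-- The norm of `𝓢_p` is `‖φ‖_p² = ∑_k (2|k| + d)^{2p} ⟨φ, h_k⟩²`. -/
theorem norm_sq_eq [NeZero d] (u : Sp d p) :
    ‖u‖ ^ 2 = ∑' k : Fin d → ℕ, hermiteEig k ^ (2 * p) * toTD u (hermiteS k) ^ 2 := by
  have h := lp.norm_rpow_eq_tsum (p := 2) (by simp) (toLp u)
  have h1 : ∀ k, ‖toLp u k‖ ^ (2 : ℝ≥0∞).toReal
      = hermiteEig k ^ (2 * p) * toTD u (hermiteS k) ^ 2 := fun k => coord_sq p (toTD u) k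
  simp only [h1] at h
  rw [← h]
  simp
  rfl

end Sp

/-! ### Brownian motion and the heat equation -/

/-- `X` is a standard `d`-dimensional Brownian motion with respect to the filtration `ℱ`, started
at `0`: it is adapted, its paths are continuous, and for `s < t` the increment `X_t - X_s` is
independent of `ℱ_s` and has density `p_{t-s}`. -/
structure IsBrownianMotion {d : ℕ} {Ω : Type*} {mΩ : MeasurableSpace Ω} (P : Measure Ω)
    (ℱ : Filtration ℝ≥0 mΩ) (X : ℝ≥0 → Ω → Euc d) : Prop where
  adapted : Adapted ℱ X
  start : ∀ᵐ ω ∂P, X 0 ω = 0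
  continuous : ∀ᵐ ω ∂P, Continuous fun t => X t ω
  indep : ∀ s t : ℝ≥0, s < t →
    Indep (MeasurableSpace.comap (fun ω => X t ω - X s ω) inferInstance) (ℱ s) P
  law : ∀ s t : ℝ≥0, s < t →
    P.map (fun ω => X t ω - X s ω) =
      volume.withDensity fun x : Euc d => ENNReal.ofReal (heatKernel ((t : ℝ) - s) x)

/-- `ψ` is an `𝓢_p`-valued solution on `[0, T]` of `∂_t ψ_t = ½ Δψ_t`, `ψ_0 = φ`: a continuous map
`[0, T] → 𝓢_p` such that `ψ_t = φ + ∫_0^t ½ Δψ_s ds` holds in `𝓢_{p-1}` for `0 ≤ t ≤ T`.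
Here `v s` is `Δψ_s` as an element of `𝓢_{p-1}`, and the integral is the Bochner integral in
`𝓢_{p-1}`. -/
def IsHeatSolution {d : ℕ} [NeZero d] {p : ℝ} (T : ℝ) (φ : Sp d p) (ψ : ℝ → Sp d p) : Prop :=
  ContinuousOn ψ (Set.Icc 0 T) ∧
  ∃ v : ℝ → Sp d (p - 1),
    (∀ s ∈ Set.Icc 0 T, Sp.toTD (v s) = laplacian (Sp.toTD (ψ s))) ∧
    ∀ t ∈ Set.Icc 0 T,
      IntervalIntegrable (fun s => (1 / 2 : ℝ) • v s) volume 0 t ∧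
      Sp.toTD (ψ t) = Sp.toTD φ + Sp.toTD (∫ s in (0 : ℝ)..t, (1 / 2 : ℝ) • v s)

end HeatSp

end

/-!
The argument lives on the Hermite side. The ladder relations for the Hermite functions give their
orthonormality and, through the exponential moments of `h_0 · g`, their completeness in `L²`. So
`𝓢_p` is isometric to `ℓ²`, Schwartz functions are dense in it, and an operator of `𝓢` with a formal
adjoint extends to `𝓢_p` as soon as it is bounded for the norms (`exists_extension`); the extension
then acts on distributions by duality.

*Translations.* The derivative `∂_j = a_j - a_j†` is the difference of the lowering and the raising
operator, which are adjoint in `𝓢_0`. In `𝓢_p` the adjointness fails only by the difference of the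
neighbouring weights `w^{2p}` and `(w+2)^{2p}`, which is smaller than the weights by a factor `w`;
this more than compensates the factor `√w` coming from the ladder operators. Hence `∂_j` is
skew-adjoint in `𝓢_p` up to a bounded form (`abs_ip_lineDeriv_add_le`), for every real `p`. It
follows that `d/dt ‖τ_{tx} f‖_p² ≤ 2 K |x| ‖τ_{tx} f‖_p²`, and Grönwall's inequality gives
`‖τ_x‖ ≤ e^{K|x|}` (`exists_translation`).

*The semigroup.* By this bound the Gaussian average `G_a φ = ∫ p_1(z) τ_{az} φ dz` (`gaussAvg`)
converges in `𝓢_p`, has norm at most an exponential moment of the Gaussian, and is strongly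
continuous in `a`. The expectation of `τ_{X_t} φ` is `G_{√t} φ`. It is `φ * p_t` by Fubini's theorem
when `φ` is a Schwartz function, and in general by density, since `φ * p_t` grows at most
polynomially, uniformly for `φ` in bounded sets of `𝓢_p` (`isGivenBy_gaussAvg`).

*The heat equation.* Differentiating `G_a φ` in `a` produces a factor `z_j` next to the Gaussian,
which integration by parts turns into another derivative: `d/da G_a φ = a Δ G_a φ`
(`hasDerivAt_toTD_gaussAvg`). Substituting `a = √t` gives the equation. For uniqueness, the skew
form above gives the monotonicity inequality `⟨Δ u, u⟩_{p-1} ≤ C ‖u‖_{p-1}²` for `u ∈ 𝓢_p`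
(`exists_inner_laplacian_le`), and Grönwall's inequality, applied to the `𝓢_{p-1}`-norm of the
difference of two solutions, shows that this difference vanishes (`IsHeatSolution.eq`).
-/

noncomputable section

namespace HeatSp

section

open LineDeriv Laplacian

/-! ### Ladder relations for the Hermite functions -/

theorem iteratedDeriv_gauss_hasDerivAt (l : ℕ) (s : ℝ) :
    HasDerivAt (iteratedDeriv l fun r : ℝ => Real.exp (-r ^ 2))
      (iteratedDeriv (l + 1) (fun r : ℝ => Real.exp (-r ^ 2)) s) s := by
  have h : ContDiff ℝ ((⊤ : ℕ∞) : WithTop ℕ∞) fun r : ℝ => Real.exp (-r ^ 2) := by fun_prop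
  rw [iteratedDeriv_succ]
  exact (h.differentiable_iteratedDeriv l (by exact_mod_cast WithTop.coe_lt_top l) s).hasDerivAt

theorem iteratedDeriv_gauss_one (s : ℝ) :
    iteratedDeriv 1 (fun r : ℝ => Real.exp (-r ^ 2)) s = -(2 * s) * Real.exp (-s ^ 2) := by
  rw [iteratedDeriv_one]
  have h1 : HasDerivAt (fun s : ℝ => Real.exp (-s ^ 2)) (Real.exp (-s ^ 2) * (-(2 * s))) s := by
    have := ((hasDerivAt_pow 2 s).neg).exp
    simpa using this
  rw [h1.deriv]; ring

theorem iteratedDeriv_gauss_rec (l : ℕ) (s : ℝ) :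
    iteratedDeriv (l + 2) (fun r : ℝ => Real.exp (-r ^ 2)) s =
      -(2 * s) * iteratedDeriv (l + 1) (fun r : ℝ => Real.exp (-r ^ 2)) s
        - 2 * (l + 1) * iteratedDeriv l (fun r : ℝ => Real.exp (-r ^ 2)) s := by
  induction l generalizing s with
  | zero =>
    have h := iteratedDeriv_gauss_hasDerivAt 1 s
    rw [funext iteratedDeriv_gauss_one] at h
    have h2 := (((hasDerivAt_id s).const_mul 2).neg).mul (iteratedDeriv_gauss_hasDerivAt 0 s)
    simp only [iteratedDeriv_zero, id] at h2
    rw [h.unique h2]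
    simp
    ring
  | succ l ih =>
    have h := iteratedDeriv_gauss_hasDerivAt (l + 2) s
    rw [funext ih] at h
    have h2 := ((((hasDerivAt_id s).const_mul 2).neg).mul
      (iteratedDeriv_gauss_hasDerivAt (l + 1) s)).sub
      ((iteratedDeriv_gauss_hasDerivAt l s).const_mul (2 * ((l : ℝ) + 1)))
    rw [show l + 1 + 2 = l + 2 + 1 by ring, h.unique h2]
    simp
    ring

theorem hermiteH_rec (l : ℕ) (s : ℝ) :
    2 * s * hermiteH l s = hermiteH (l + 1) s + 2 * l * hermiteH (l - 1) s := by
  cases l with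
  | zero => simp [hermiteH, iteratedDeriv_gauss_one]; ring
  | succ l =>
    simp only [hermiteH, Nat.add_sub_cancel, iteratedDeriv_gauss_rec l s, Nat.cast_add, Nat.cast_one,
      show l + 1 + 1 = l + 2 by ring]
    ring

theorem hasDerivAt_hermiteH (l : ℕ) (s : ℝ) :
    HasDerivAt (hermiteH l) (2 * l * hermiteH (l - 1) s) s := by
  have h1 : HasDerivAt (fun s : ℝ => Real.exp (s ^ 2)) (Real.exp (s ^ 2) * (2 * s)) s := by
    have := (hasDerivAt_pow 2 s).exp
    simpa using this
  have h := (h1.const_mul ((-1 : ℝ) ^ l)).mul (iteratedDeriv_gauss_hasDerivAt l s)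
  convert! h using 1
  have := hermiteH_rec l s
  simp only [hermiteH] at this ⊢
  rw [pow_succ (-1 : ℝ) l] at this
  linear_combination -this

theorem hermite_norm_const_succ (l : ℕ) :
    (Real.sqrt (Real.sqrt Real.pi * 2 ^ (l + 1) * (l + 1).factorial))⁻¹ * Real.sqrt (((l : ℝ) + 1) / 2)
      = (Real.sqrt (Real.sqrt Real.pi * 2 ^ l * l.factorial))⁻¹ / 2 := by
  have h1 : Real.sqrt Real.pi * 2 ^ (l + 1) * (l + 1).factorial
      = Real.sqrt Real.pi * 2 ^ l * l.factorial * (2 ^ 2 * (((l : ℝ) + 1) / 2)) := by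
    rw [Nat.factorial_succ]; push_cast; ring
  have h2 : 0 < Real.sqrt (((l : ℝ) + 1) / 2) := Real.sqrt_pos.2 (by positivity)
  have h3 : 0 < Real.sqrt (Real.sqrt Real.pi * 2 ^ l * l.factorial) :=
    Real.sqrt_pos.2 (by have := Real.pi_pos; positivity)
  rw [h1, Real.sqrt_mul (by positivity) (2 ^ 2 * (((l : ℝ) + 1) / 2)),
    Real.sqrt_mul (by positivity) (((l : ℝ) + 1) / 2), Real.sqrt_sq (by norm_num)]
  field_simp

theorem hermite_norm_const_pred (l : ℕ) :
    (Real.sqrt (Real.sqrt Real.pi * 2 ^ l * l.factorial))⁻¹ * l =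
      Real.sqrt ((l : ℝ) / 2) *
        (Real.sqrt (Real.sqrt Real.pi * 2 ^ (l - 1) * (l - 1).factorial))⁻¹ := by
  cases l with
  | zero => simp
  | succ l =>
    have h := hermite_norm_const_succ l
    have h2 : Real.sqrt (((l : ℝ) + 1) / 2) * Real.sqrt (((l : ℝ) + 1) / 2) = ((l : ℝ) + 1) / 2 :=
      Real.mul_self_sqrt (by positivity)
    simp only [Nat.add_sub_cancel, Nat.cast_add, Nat.cast_one]
    linear_combination (-2) * (Real.sqrt (Real.sqrt Real.pi * 2 ^ (l + 1) * (l + 1).factorial))⁻¹ * h2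
      + 2 * Real.sqrt (((l : ℝ) + 1) / 2) * h

/-- Multiplication by `s` on the Hermite functions. For `l = 0` the truncated index `l - 1` is
harmless, as its coefficient vanishes; the same holds in all ladder relations below. -/
theorem mul_hermite1 (l : ℕ) (s : ℝ) :
    s * hermite1 l s = Real.sqrt ((l : ℝ) / 2) * hermite1 (l - 1) s
      + Real.sqrt (((l : ℝ) + 1) / 2) * hermite1 (l + 1) s := by
  have h1 := hermite_norm_const_succ l
  have h2 := hermite_norm_const_pred l
  have h3 := hermiteH_rec l s
  simp only [hermite1]
  linear_combination Real.exp (-s ^ 2 / 2) * ((Real.sqrt (Real.sqrt Real.pi * 2 ^ l * l.factorial))⁻¹ / 2 * h3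
    + hermiteH (l - 1) s * h2 - hermiteH (l + 1) s * h1)

theorem hasDerivAt_hermite1 (l : ℕ) (s : ℝ) :
    HasDerivAt (hermite1 l) (Real.sqrt ((l : ℝ) / 2) * hermite1 (l - 1) s
      - Real.sqrt (((l : ℝ) + 1) / 2) * hermite1 (l + 1) s) s := by
  have h0 : HasDerivAt (fun s : ℝ => Real.exp (-s ^ 2 / 2)) (Real.exp (-s ^ 2 / 2) * (-s)) s := by
    have := (((hasDerivAt_pow 2 s).neg).div_const 2).exp
    convert! this using 1
    simp
    ring
  have h := (h0.const_mul (Real.sqrt (Real.sqrt Real.pi * 2 ^ l * l.factorial))⁻¹).mul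
    (hasDerivAt_hermiteH l s)
  convert! h using 1
  have h1 := hermite_norm_const_succ l
  have h2 := hermite_norm_const_pred l
  have h3 := hermiteH_rec l s
  simp only [hermite1]
  linear_combination Real.exp (-s ^ 2 / 2) * ((Real.sqrt (Real.sqrt Real.pi * 2 ^ l * l.factorial))⁻¹ / 2 * h3
    - hermiteH (l - 1) s * h2 - hermiteH (l + 1) s * h1)

variable {d : ℕ}

/-- The multi-index `k` with its `j`-th entry raised by one. -/
def up (j : Fin d) (k : Fin d → ℕ) : Fin d → ℕ := Function.update k j (k j + 1)

/-- The multi-index `k` with its `j`-th entry lowered by one (and unchanged if that entry is `0`). -/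
def dn (j : Fin d) (k : Fin d → ℕ) : Fin d → ℕ := Function.update k j (k j - 1)

theorem dn_up (j : Fin d) (k : Fin d → ℕ) : dn j (up j k) = k := by simp [dn, up]

theorem up_dn {j : Fin d} {k : Fin d → ℕ} (h : k j ≠ 0) : up j (dn j k) = k := by
  have : k j - 1 + 1 = k j := by omega
  simp [dn, up, this]

theorem up_injective (j : Fin d) : Function.Injective (up j : (Fin d → ℕ) → _) :=
  Function.LeftInverse.injective (dn_up j)

@[simp] theorem up_same (j : Fin d) (k : Fin d → ℕ) : up j k j = k j + 1 := by simp [up]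

@[simp] theorem dn_same (j : Fin d) (k : Fin d → ℕ) : dn j k j = k j - 1 := by simp [dn]

theorem sum_up (j : Fin d) (k : Fin d → ℕ) : ∑ i, up j k i = ∑ i, k i + 1 := by
  rw [up, Finset.sum_update_of_mem (Finset.mem_univ j), ← Finset.add_sum_erase _ k (Finset.mem_univ j),
    Finset.sdiff_singleton_eq_erase]
  ring

theorem hermiteEig_up (j : Fin d) (k : Fin d → ℕ) : hermiteEig (up j k) = hermiteEig k + 2 := by
  rw [hermiteEig, hermiteEig, sum_up]
  push_cast
  ring

theorem hermiteFun_update (k : Fin d → ℕ) (j : Fin d) (n : ℕ) (x : Euc d) :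
    hermiteFun (Function.update k j n) x
      = hermite1 n (x j) * ∏ i ∈ Finset.univ.erase j, hermite1 (k i) (x i) := by
  rw [hermiteFun, ← Finset.mul_prod_erase _ _ (Finset.mem_univ j)]
  congr 1
  · simp
  · refine Finset.prod_congr rfl fun i hi => ?_
    rw [Function.update_of_ne (Finset.ne_of_mem_erase hi)]

theorem hermiteFun_eq (k : Fin d → ℕ) (j : Fin d) (x : Euc d) :
    hermiteFun k x = hermite1 (k j) (x j) * ∏ i ∈ Finset.univ.erase j, hermite1 (k i) (x i) := by
  rw [← hermiteFun_update, Function.update_eq_self]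

theorem mul_hermiteS (j : Fin d) (k : Fin d → ℕ) (x : Euc d) :
    x j * hermiteS k x = Real.sqrt ((k j : ℝ) / 2) * hermiteS (dn j k) x
      + Real.sqrt (((k j : ℝ) + 1) / 2) * hermiteS (up j k) x := by
  change x j * hermiteFun k x = _ * hermiteFun _ x + _ * hermiteFun _ x
  rw [dn, up, hermiteFun_update, hermiteFun_update, hermiteFun_eq k j, ← mul_assoc, mul_hermite1]
  ring

/-- The `j`-th standard basis vector of `ℝ^d`. -/
def basisVec (j : Fin d) : Euc d := EuclideanSpace.single j 1

theorem lineDeriv_hermiteS (j : Fin d) (k : Fin d → ℕ) :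
    ∂_{basisVec j} (hermiteS k) = Real.sqrt ((k j : ℝ) / 2) • hermiteS (dn j k)
      - Real.sqrt (((k j : ℝ) + 1) / 2) • hermiteS (up j k) := by
  ext x
  rw [SchwartzMap.lineDerivOp_apply, lineDeriv]
  have h0 : ∀ t : ℝ, (hermiteS k) (x + t • basisVec j) = hermite1 (k j) (x j + t) *
      ∏ i ∈ Finset.univ.erase j, hermite1 (k i) (x i) := by
    intro t
    change hermiteFun k _ = _
    rw [hermiteFun_eq k j]
    congr 1
    · simp [basisVec]
    · refine Finset.prod_congr rfl fun i hi => ?_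
      simp [basisVec, Finset.ne_of_mem_erase hi]
  rw [funext h0]
  have h1 := ((hasDerivAt_hermite1 (k j) (x j + 0)).comp_const_add (x j) 0).mul_const
    (∏ i ∈ Finset.univ.erase j, hermite1 (k i) (x i))
  rw [h1.deriv]
  change _ = Real.sqrt ((k j : ℝ) / 2) * hermiteFun _ x - Real.sqrt (((k j : ℝ) + 1) / 2) * hermiteFun _ x
  rw [dn, up, hermiteFun_update, hermiteFun_update, add_zero]
  ring

theorem basisVec_eq (j : Fin d) : basisVec j = EuclideanSpace.basisFun (Fin d) ℝ j := by
  simp [basisVec]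

theorem laplacian_eq_sum_basisVec (f : 𝓢(Euc d, ℝ)) :
    Δ f = ∑ j : Fin d, ∂_{basisVec j} (∂_{basisVec j} f : 𝓢(Euc d, ℝ)) := by
  rw [SchwartzMap.laplacian_eq_sum (EuclideanSpace.basisFun (Fin d) ℝ)]
  simp only [basisVec_eq]

theorem lineDerivOp_linear (v : Euc d) (a b : ℝ) (f g : 𝓢(Euc d, ℝ)) :
    ∂_{v} (a • f + b • g) = a • ∂_{v} f + b • ∂_{v} g := by
  rw [lineDerivOp_add, lineDerivOp_smul, lineDerivOp_smul]

theorem lower_hermiteS (j : Fin d) (k : Fin d → ℕ) (x : Euc d) :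
    x j * hermiteS k x + ∂_{basisVec j} (hermiteS k) x
      = 2 * Real.sqrt ((k j : ℝ) / 2) * hermiteS (dn j k) x := by
  rw [mul_hermiteS, lineDeriv_hermiteS]
  simp only [sub_apply, smul_apply, smul_eq_mul]
  ring

theorem raise_hermiteS (j : Fin d) (k : Fin d → ℕ) (x : Euc d) :
    x j * hermiteS k x - ∂_{basisVec j} (hermiteS k) x
      = 2 * Real.sqrt (((k j : ℝ) + 1) / 2) * hermiteS (up j k) x := by
  rw [mul_hermiteS, lineDeriv_hermiteS]
  simp only [sub_apply, smul_apply, smul_eq_mul]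
  ring

/-- The Hermite functions are eigenfunctions of `x_j² - ∂_j²`, since this is
`(x_j - ∂_j)(x_j + ∂_j) + 1`. -/
theorem sq_mul_sub_lineDeriv_hermiteS (j : Fin d) (k : Fin d → ℕ) (x : Euc d) :
    x j ^ 2 * hermiteS k x - ∂_{basisVec j} (∂_{basisVec j} (hermiteS k)) x
      = (2 * k j + 1) * hermiteS k x := by
  have h1 : ∂_{basisVec j} (∂_{basisVec j} (hermiteS k)) x =
      Real.sqrt ((k j : ℝ) / 2) * ∂_{basisVec j} (hermiteS (dn j k)) x
      - Real.sqrt (((k j : ℝ) + 1) / 2) * ∂_{basisVec j} (hermiteS (up j k)) x := by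
    rw [lineDeriv_hermiteS j k, sub_eq_add_neg, ← neg_smul, lineDerivOp_linear]
    simp only [add_apply, smul_apply, smul_eq_mul]
    ring
  have h2 := mul_hermiteS j k x
  have h3 := raise_hermiteS j (dn j k) x
  have h4 := lower_hermiteS j (up j k) x
  rw [dn_up, up_same] at h4
  have h5 : Real.sqrt (((k j : ℝ) + 1) / 2) * Real.sqrt (((k j : ℝ) + 1) / 2) = ((k j : ℝ) + 1) / 2 :=
    Real.mul_self_sqrt (by positivity)
  have h6 : Real.sqrt ((k j : ℝ) / 2) *
      (x j * hermiteS (dn j k) x - ∂_{basisVec j} (hermiteS (dn j k)) x) = k j * hermiteS k x := by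
    rcases eq_or_ne (k j) 0 with h0 | h0
    · simp [h0]
    · have h7 : Real.sqrt ((k j : ℝ) / 2) * Real.sqrt ((k j : ℝ) / 2) = (k j : ℝ) / 2 :=
        Real.mul_self_sqrt (by positivity)
      rw [h3, up_dn h0, dn_same, Nat.cast_sub (by omega), Nat.cast_one, sub_add_cancel]
      linear_combination 2 * hermiteS k x * h7
  push_cast at h4
  rw [h1]
  linear_combination x j * h2 + h6 + Real.sqrt (((k j : ℝ) + 1) / 2) * h4
    + 2 * hermiteS k x * h5

/-- The harmonic oscillator `|x|² - Δ` on the Schwartz space. -/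
def harmonic (d : ℕ) : 𝓢(Euc d, ℝ) →L[ℝ] 𝓢(Euc d, ℝ) :=
  SchwartzMap.smulLeftCLM ℝ (fun x : Euc d => ‖x‖ ^ 2) - laplacianCLM ℝ (Euc d) 𝓢(Euc d, ℝ)

theorem harmonic_apply (f : 𝓢(Euc d, ℝ)) (x : Euc d) :
    harmonic d f x = ‖x‖ ^ 2 * f x - Δ f x := by
  rw [harmonic, sub_apply, sub_apply,
    SchwartzMap.smulLeftCLM_apply_apply (by fun_prop)]
  rfl

theorem harmonic_hermiteS (k : Fin d → ℕ) :
    harmonic d (hermiteS k) = hermiteEig k • hermiteS k := by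
  ext x
  rw [harmonic_apply, laplacian_eq_sum_basisVec, EuclideanSpace.norm_sq_eq, sum_apply,
    Finset.sum_mul, ← Finset.sum_sub_distrib]
  simp only [Real.norm_eq_abs, sq_abs, sq_mul_sub_lineDeriv_hermiteS, smul_apply, smul_eq_mul]
  rw [← Finset.sum_mul, hermiteEig, Finset.sum_add_distrib, ← Finset.mul_sum]
  simp

theorem integrable_schwartz_mul (f g : 𝓢(Euc d, ℝ)) : Integrable fun x => f x * g x := by
  have := (SchwartzMap.pairing (ContinuousLinearMap.mul ℝ ℝ) f g).integrable (μ := volume)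
  exact this

theorem integral_harmonic_mul (f g : 𝓢(Euc d, ℝ)) :
    ∫ x, harmonic d f x * g x = ∫ x, f x * harmonic d g x := by
  have h := SchwartzMap.integral_mul_laplacian_right_eq_left f g (μ := volume)
  have e : ∀ f g : 𝓢(Euc d, ℝ), Integrable fun x : Euc d => (‖x‖ ^ 2 * f x) * g x := fun f g => by
    refine (integrable_schwartz_mul (SchwartzMap.smulLeftCLM ℝ (fun x : Euc d => ‖x‖ ^ 2) f)
      g).congr (Eventually.of_forall fun x => ?_)
    simp only [SchwartzMap.smulLeftCLM_apply_apply
      (show (fun x : Euc d => ‖x‖ ^ 2).HasTemperateGrowth by fun_prop), smul_eq_mul]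
  have e1 : ∫ x, harmonic d f x * g x = (∫ x, (‖x‖ ^ 2 * f x) * g x) - ∫ x, Δ f x * g x := by
    rw [← integral_sub (e f g) (integrable_schwartz_mul _ _)]
    simp only [harmonic_apply, sub_mul]
  have e2 : ∫ x, f x * harmonic d g x = (∫ x, (‖x‖ ^ 2 * f x) * g x) - ∫ x, f x * Δ g x := by
    rw [← integral_sub (e f g) (integrable_schwartz_mul _ _)]
    congr 1; ext x
    rw [harmonic_apply]; ring
  rw [e1, e2, h]

theorem integrable_coord_mul (j : Fin d) (f g : 𝓢(Euc d, ℝ)) :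
    Integrable fun x : Euc d => (x j * f x) * g x := by
  have hj : (fun x : Euc d => x j).HasTemperateGrowth :=
    (EuclideanSpace.proj (𝕜 := ℝ) j).hasTemperateGrowth
  refine (integrable_schwartz_mul (SchwartzMap.smulLeftCLM ℝ (fun x : Euc d => x j) f)
      g).congr (Eventually.of_forall fun x => ?_)
  simp only [SchwartzMap.smulLeftCLM_apply_apply hj, smul_eq_mul]

/-- The adjointness of the raising and lowering operators, tested on Hermite functions. -/
theorem sqrt_mul_integral_up (j : Fin d) (k m : Fin d → ℕ) :
    Real.sqrt (((k j : ℝ) + 1) / 2) * ∫ x, hermiteS (up j k) x * hermiteS m x =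
      Real.sqrt ((m j : ℝ) / 2) * ∫ x, hermiteS k x * hermiteS (dn j m) x := by
  have h := SchwartzMap.integral_mul_lineDerivOp_right_eq_neg_left (hermiteS k) (hermiteS m)
    (basisVec j) (μ := volume)
  have e1 : 2 * Real.sqrt (((k j : ℝ) + 1) / 2) * ∫ x, hermiteS (up j k) x * hermiteS m x =
      (∫ x : Euc d, (x j * hermiteS k x) * hermiteS m x)
        - ∫ x, ∂_{basisVec j} (hermiteS k) x * hermiteS m x := by
    rw [← integral_sub (integrable_coord_mul _ _ _) (integrable_schwartz_mul _ _),
      ← integral_const_mul]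
    congr 1; ext x
    rw [← mul_assoc, ← raise_hermiteS]; ring
  have e2 : 2 * Real.sqrt ((m j : ℝ) / 2) * ∫ x, hermiteS k x * hermiteS (dn j m) x =
      (∫ x : Euc d, (x j * hermiteS k x) * hermiteS m x)
        + ∫ x, hermiteS k x * ∂_{basisVec j} (hermiteS m) x := by
    rw [← integral_add (integrable_coord_mul _ _ _) (integrable_schwartz_mul _ _),
      ← integral_const_mul]
    congr 1; ext x
    rw [mul_left_comm, ← lower_hermiteS]; ring
  linarith

theorem hermiteFun_zero (x : Euc d) :
    hermiteFun (0 : Fin d → ℕ) x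
      = (Real.sqrt (Real.sqrt Real.pi))⁻¹ ^ d * Real.exp (-(1 / 2) * ‖x‖ ^ 2) := by
  rw [hermiteFun, EuclideanSpace.norm_sq_eq, Finset.mul_sum, Real.exp_sum]
  have : ∀ j : Fin d, hermite1 ((0 : Fin d → ℕ) j) (x j) =
      (Real.sqrt (Real.sqrt Real.pi))⁻¹ * Real.exp (-(1 / 2) * ‖x j‖ ^ 2) := by
    intro j
    simp only [Pi.zero_apply, hermite1, hermiteH, Real.norm_eq_abs, sq_abs]
    rw [iteratedDeriv_zero, mul_assoc ((-1 : ℝ) ^ 0), ← Real.exp_add, add_neg_cancel]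
    simp
    left
    ring
  simp only [this, Finset.prod_mul_distrib]
  simp

theorem integral_hermiteS_zero : ∫ x, hermiteS (0 : Fin d → ℕ) x * hermiteS 0 x = 1 := by
  have h := GaussianFourier.integral_rexp_neg_mul_sq_norm (V := Euc d) (b := 1) one_pos
  have e : ∀ x : Euc d, hermiteS (0 : Fin d → ℕ) x * hermiteS 0 x =
      (Real.sqrt Real.pi)⁻¹ ^ d * Real.exp (-1 * ‖x‖ ^ 2) := by
    intro x
    change hermiteFun 0 x * hermiteFun 0 x = _
    rw [hermiteFun_zero, mul_mul_mul_comm, ← mul_pow, ← mul_inv,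
      Real.mul_self_sqrt (Real.sqrt_nonneg _), ← Real.exp_add]
    ring_nf
  simp only [e, integral_const_mul, h]
  rw [finrank_euclideanSpace_fin, div_one, Real.sqrt_eq_rpow, inv_pow, ← Real.rpow_mul_natCast
    Real.pi_pos.le, one_div_mul_eq_div]
  exact inv_mul_cancel₀ (Real.rpow_pos_of_pos Real.pi_pos _).ne'

/-- Orthonormality of the Hermite functions, by induction on `|k|` with the ladder operators. This
also distinguishes the `h_k` that share an eigenvalue of the harmonic oscillator. -/
theorem integral_hermiteS_mul (k m : Fin d → ℕ) :
    ∫ x, hermiteS k x * hermiteS m x = if k = m then 1 else 0 := by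
  induction h : ∑ i, k i generalizing k m with
  | zero =>
    have hk : k = 0 := by
      funext i
      exact (Finset.sum_eq_zero_iff.1 h) i (Finset.mem_univ i)
    subst hk
    split_ifs with hm
    · subst hm; exact integral_hermiteS_zero
    · obtain ⟨j, hj⟩ := Function.ne_iff.1 (Ne.symm hm)
      have h1 := sqrt_mul_integral_up j (dn j m) (0 : Fin d → ℕ)
      rw [up_dn hj] at h1
      have h2 : 0 < Real.sqrt (((dn j m j : ℝ) + 1) / 2) := Real.sqrt_pos.2 (by positivity)
      simp only [Pi.zero_apply, Nat.cast_zero, zero_div, Real.sqrt_zero, zero_mul] at h1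
      rcases mul_eq_zero.1 h1 with h3 | h3
      · exact absurd h3 h2.ne'
      · rw [← h3]; congr 1; ext x; ring
  | succ n ih =>
    obtain ⟨j, hj⟩ : ∃ j, k j ≠ 0 := by
      by_contra! hc
      simp [hc] at h
    have h1 := sqrt_mul_integral_up j (dn j k) m
    have hs : ∑ i, dn j k i = n := by
      have := sum_up j (dn j k)
      rw [up_dn hj] at this
      omega
    rw [up_dn hj, ih (dn j k) (dn j m) hs, dn_same, Nat.cast_sub (by omega), Nat.cast_one,
      sub_add_cancel] at h1
    have hpos : 0 < Real.sqrt ((k j : ℝ) / 2) :=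
      Real.sqrt_pos.2 (by have := Nat.pos_of_ne_zero hj; positivity)
    rcases eq_or_ne (m j) 0 with hm | hm
    · rw [if_neg (by rintro rfl; exact hj hm)]
      simp only [hm, Nat.cast_zero, zero_div, Real.sqrt_zero, zero_mul] at h1
      exact (mul_eq_zero.1 h1).resolve_left hpos.ne'
    · have h2 : dn j k = dn j m ↔ k = m := by
        refine ⟨fun h => ?_, fun h => by rw [h]⟩
        rw [← up_dn hj, h, up_dn hm]
      simp only [h2] at h1
      split_ifs at h1 ⊢ with hkm
      · subst hkm
        exact mul_left_cancel₀ hpos.ne' h1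
      · rw [mul_zero] at h1
        exact (mul_eq_zero.1 h1).resolve_left hpos.ne'

end

section

variable {d : ℕ}

/-! ### Completeness of the Hermite functions in `L²` -/

theorem inner_toL2 (f g : 𝓢(Euc d, ℝ)) :
    inner ℝ (f.toLp 2 (volume : Measure (Euc d))) (g.toLp 2 volume) = ∫ x, f x * g x := by
  rw [L2.inner_def]
  refine integral_congr_ae ?_
  filter_upwards [f.coeFn_toLp 2 (volume : Measure (Euc d)),
    g.coeFn_toLp 2 (volume : Measure (Euc d))] with x hf hg
  rw [hf, hg]
  simp [mul_comm]

theorem inner_toL2_left (f : 𝓢(Euc d, ℝ)) (g : Lp ℝ 2 (volume : Measure (Euc d))) :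
    inner ℝ (f.toLp 2 (volume : Measure (Euc d))) g = ∫ x, f x * g x := by
  rw [L2.inner_def]
  refine integral_congr_ae ?_
  filter_upwards [f.coeFn_toLp 2 (volume : Measure (Euc d))] with x hf
  rw [hf]
  simp [mul_comm]

theorem orthonormal_hermiteS :
    Orthonormal ℝ fun k : Fin d → ℕ => (hermiteS k).toLp 2 (volume : Measure (Euc d)) := by
  rw [orthonormal_iff_ite]
  intro k m
  rw [inner_toL2, integral_hermiteS_mul]

theorem mul_inner_mem_span (ξ : Euc d) {f : 𝓢(Euc d, ℝ)}
    (hf : f ∈ Submodule.span ℝ (Set.range (hermiteS : (Fin d → ℕ) → 𝓢(Euc d, ℝ)))) :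
    SchwartzMap.smulLeftCLM ℝ (fun x : Euc d => inner ℝ x ξ) f ∈
      Submodule.span ℝ (Set.range (hermiteS : (Fin d → ℕ) → 𝓢(Euc d, ℝ))) := by
  have hξ : (fun x : Euc d => inner ℝ x ξ).HasTemperateGrowth := by fun_prop
  induction hf using Submodule.span_induction with
  | mem f hf =>
    obtain ⟨k, rfl⟩ := hf
    have : SchwartzMap.smulLeftCLM ℝ (fun x : Euc d => inner ℝ x ξ) (hermiteS k) =
        ∑ j, ξ j • (Real.sqrt ((k j : ℝ) / 2) • hermiteS (dn j k)
          + Real.sqrt (((k j : ℝ) + 1) / 2) • hermiteS (up j k)) := by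
      ext x
      rw [SchwartzMap.smulLeftCLM_apply_apply hξ, sum_apply]
      simp only [smul_apply, add_apply, smul_eq_mul, ← mul_hermiteS]
      rw [PiLp.inner_apply, Finset.sum_mul]
      refine Finset.sum_congr rfl fun j _ => ?_
      simp
      ring
    rw [this]
    refine Submodule.sum_mem _ fun j _ => Submodule.smul_mem _ _ (Submodule.add_mem _ ?_ ?_) <;>
      exact Submodule.smul_mem _ _ (Submodule.subset_span ⟨_, rfl⟩)
  | zero => rw [map_zero]; exact Submodule.zero_mem _
  | add f g _ _ hf hg => rw [map_add]; exact Submodule.add_mem _ hf hg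
  | smul c f _ hf => rw [map_smul]; exact Submodule.smul_mem _ _ hf

/-- The products `⟨x, ξ⟩ ^ n h_0(x)` are finite linear combinations of Hermite functions. -/
theorem exists_mem_span_eq_inner_pow (ξ : Euc d) (n : ℕ) :
    ∃ f ∈ Submodule.span ℝ (Set.range (hermiteS : (Fin d → ℕ) → 𝓢(Euc d, ℝ))),
      ∀ x, f x = (inner ℝ x ξ) ^ n * hermiteS 0 x := by
  have hξ : (fun x : Euc d => inner ℝ x ξ).HasTemperateGrowth := by fun_prop
  induction n with
  | zero => exact ⟨hermiteS 0, Submodule.subset_span ⟨0, rfl⟩, fun x => by simp⟩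
  | succ n ih =>
    obtain ⟨f, hf, hfx⟩ := ih
    refine ⟨_, mul_inner_mem_span ξ hf, fun x => ?_⟩
    rw [SchwartzMap.smulLeftCLM_apply_apply hξ, hfx, pow_succ, smul_eq_mul]
    ring

theorem integral_inner_pow_mul_eq_zero {g : Lp ℝ 2 (volume : Measure (Euc d))}
    (hg : ∀ k : Fin d → ℕ, inner ℝ ((hermiteS k).toLp 2 (volume : Measure (Euc d))) g = 0)
    (ξ : Euc d) (n : ℕ) : ∫ x, (inner ℝ x ξ) ^ n * (hermiteS 0 x * g x) = 0 := by
  obtain ⟨f, hf, hfx⟩ := exists_mem_span_eq_inner_pow ξ n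
  have h : ∀ f ∈ Submodule.span ℝ (Set.range (hermiteS : (Fin d → ℕ) → 𝓢(Euc d, ℝ))),
      inner ℝ (f.toLp 2 (volume : Measure (Euc d))) g = 0 := by
    intro f hf
    rw [← SchwartzMap.toLpCLM_apply (𝕜 := ℝ)]
    induction hf using Submodule.span_induction with
    | mem f hf => obtain ⟨k, rfl⟩ := hf; exact hg k
    | zero => rw [map_zero, inner_zero_left]
    | add f f' _ _ hf hg => rw [map_add, inner_add_left, hf, hg, add_zero]
    | smul c f _ hf => rw [map_smul, inner_smul_left, hf, mul_zero]
  rw [← h f hf, inner_toL2_left]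
  simp only [hfx, mul_assoc]

theorem exp_inner_mul_hermiteS_zero_le (ξ x : Euc d) :
    Real.exp |inner ℝ x ξ| * |hermiteS (0 : Fin d → ℕ) x| ≤
      (Real.exp (‖ξ‖ ^ 2) * (Real.sqrt (Real.sqrt Real.pi))⁻¹ ^ d) *
        gaussian d (1 / 4) (by norm_num) x := by
  have e : hermiteS (0 : Fin d → ℕ) x =
    (Real.sqrt (Real.sqrt Real.pi))⁻¹ ^ d * Real.exp (-(1 / 2) * ‖x‖ ^ 2) := hermiteFun_zero x
  change _ ≤ _ * Real.exp (-(1 / 4) * ‖x‖ ^ 2)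
  have h3 : 0 ≤ (Real.sqrt (Real.sqrt Real.pi))⁻¹ ^ d := by positivity
  rw [e, abs_of_nonneg (mul_nonneg h3 (Real.exp_pos _).le)]
  have h1 : |inner ℝ x ξ| ≤ ‖x‖ * ‖ξ‖ := abs_real_inner_le_norm x ξ
  have h2 : Real.exp |inner ℝ x ξ| * Real.exp (-(1 / 2) * ‖x‖ ^ 2) ≤
      Real.exp (‖ξ‖ ^ 2) * Real.exp (-(1 / 4) * ‖x‖ ^ 2) := by
    rw [← Real.exp_add, ← Real.exp_add]
    refine Real.exp_le_exp.2 ?_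
    nlinarith [sq_nonneg (‖x‖ / 2 - ‖ξ‖)]
  nlinarith [mul_le_mul_of_nonneg_left h2 h3]

theorem integrable_exp_inner_mul (g : Lp ℝ 2 (volume : Measure (Euc d))) (ξ : Euc d) :
    Integrable fun x => Real.exp |inner ℝ x ξ| * |hermiteS (0 : Fin d → ℕ) x * g x| := by
  have h1 : Integrable fun x => gaussian d (1 / 4) (by norm_num) x * g x :=
    ((gaussian d (1 / 4) (by norm_num)).memLp 2 volume).integrable_mul (Lp.memLp g)
  refine (h1.norm.const_mul (Real.exp (‖ξ‖ ^ 2) * (Real.sqrt (Real.sqrt Real.pi))⁻¹ ^ d)).mono' ?_ ?_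
  · have h2 : Continuous fun x : Euc d => Real.exp |inner ℝ x ξ| := by fun_prop
    exact h2.aestronglyMeasurable.mul
      (((hermiteS 0).continuous.aestronglyMeasurable.mul (Lp.aestronglyMeasurable g)).norm)
  · refine Eventually.of_forall fun x => ?_
    rw [Real.norm_of_nonneg (by positivity), norm_mul, abs_mul, ← mul_assoc, ← mul_assoc,
      Real.norm_eq_abs, Real.norm_eq_abs]
    refine mul_le_mul_of_nonneg_right ((exp_inner_mul_hermiteS_zero_le ξ x).trans ?_) (abs_nonneg _)
    gcongr
    exact le_abs_self _

/-- If `g` is orthogonal to all Hermite functions, then the Fourier transform of `h_0 g` vanishes: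
expand the character into its power series. -/
theorem integral_char_mul_eq_zero {g : Lp ℝ 2 (volume : Measure (Euc d))}
    (hg : ∀ k : Fin d → ℕ, inner ℝ ((hermiteS k).toLp 2 (volume : Measure (Euc d))) g = 0)
    (ξ : Euc d) :
    ∫ x, ((hermiteS 0 x * g x : ℝ) : ℂ) * Complex.exp (↑(inner ℝ x ξ) * Complex.I) = 0 := by
  have hS := hasSum_integral_of_dominated_convergence (μ := (volume : Measure (Euc d)))
    (F := fun (n : ℕ) (x : Euc d) => ((hermiteS 0 x * g x : ℝ) : ℂ) *
      ((↑(inner ℝ x ξ) * Complex.I) ^ n / (n.factorial : ℂ)))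
    (f := fun x => ((hermiteS 0 x * g x : ℝ) : ℂ) * Complex.exp (↑(inner ℝ x ξ) * Complex.I))
    (fun n x => |hermiteS 0 x * g x| * (|inner ℝ x ξ| ^ n / n.factorial))
    (fun n => by
      refine AEStronglyMeasurable.mul ?_ ?_
      · exact Complex.continuous_ofReal.comp_aestronglyMeasurable
          ((hermiteS 0).continuous.aestronglyMeasurable.mul (Lp.aestronglyMeasurable g))
      · exact Continuous.aestronglyMeasurable (by fun_prop))
    (fun n => Eventually.of_forall fun x => by
      rw [norm_mul, Complex.norm_real, norm_div, norm_pow, norm_mul (inner ℝ x ξ : ℂ), Complex.norm_I,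
        Complex.norm_real, mul_one, Complex.norm_natCast, Real.norm_eq_abs, Real.norm_eq_abs])
    (Eventually.of_forall fun x => (Real.summable_pow_div_factorial _).mul_left _)
    (by
      refine (integrable_exp_inner_mul g ξ).congr (Eventually.of_forall fun x => ?_)
      simp only [tsum_mul_left]
      rw [mul_comm, Real.exp_eq_exp_ℝ, NormedSpace.exp_eq_tsum_div])
    (Eventually.of_forall fun x => by
      refine HasSum.mul_left _ ?_
      rw [Complex.exp_eq_exp_ℂ]
      exact NormedSpace.expSeries_div_hasSum_exp _)
  refine hS.unique ?_
  convert! hasSum_zero (α := ℂ) (β := ℕ) using 1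
  funext n
  have h0 := integral_inner_pow_mul_eq_zero hg ξ n
  have e : ∀ x, ((hermiteS 0 x * g x : ℝ) : ℂ) * ((↑(inner ℝ x ξ) * Complex.I) ^ n / (n.factorial : ℂ))
      = (Complex.I ^ n / (n.factorial : ℂ)) * (((inner ℝ x ξ) ^ n * (hermiteS 0 x * g x) : ℝ) : ℂ) := by
    intro x
    push_cast
    ring
  simp only [e]
  rw [integral_const_mul, integral_complex_ofReal, h0]
  simp

/-- Completeness of the Hermite functions in `L²`. -/
theorem eq_zero_of_forall_inner_hermiteS {g : Lp ℝ 2 (volume : Measure (Euc d))}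
    (hg : ∀ k : Fin d → ℕ, inner ℝ ((hermiteS k).toLp 2 (volume : Measure (Euc d))) g = 0) :
    g = 0 := by
  set G : Euc d → ℝ := fun x => hermiteS 0 x * g x with hG
  have hGm : Measurable G :=
    (hermiteS 0).continuous.measurable.mul (Lp.stronglyMeasurable g).measurable
  have hGn : Measurable fun x => -G x := hGm.neg
  have hGi : Integrable G := ((hermiteS 0).memLp 2 volume).integrable_mul (Lp.memLp g)
  have f1 : IsFiniteMeasure ((volume : Measure (Euc d)).withDensity fun x => ENNReal.ofReal (G x)) :=
    isFiniteMeasure_withDensity_ofReal hGi.2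
  have f2 : IsFiniteMeasure ((volume : Measure (Euc d)).withDensity fun x => ENNReal.ofReal (-G x)) :=
    isFiniteMeasure_withDensity_ofReal hGi.neg.2
  -- The positive and the negative part of `h_0 g` have the same characteristic function.
  have key : (volume : Measure (Euc d)).withDensity (fun x => ENNReal.ofReal (G x)) =
      (volume : Measure (Euc d)).withDensity fun x => ENNReal.ofReal (-G x) := by
    refine Measure.ext_of_charFun (funext fun ξ => ?_)
    have hb : ∀ H : Euc d → ℝ, Integrable H → Integrable fun x =>
        (ENNReal.ofReal (H x)).toReal • Complex.exp (↑(inner ℝ x ξ) * Complex.I) := by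
      intro H hH
      refine hH.norm.mono' (hH.1.aemeasurable.ennreal_ofReal.ennreal_toReal.aestronglyMeasurable.smul
        (Continuous.aestronglyMeasurable (by fun_prop))) (Eventually.of_forall fun x => ?_)
      rw [norm_smul, Complex.norm_exp_ofReal_mul_I, mul_one, ENNReal.toReal_ofReal', Real.norm_eq_abs,
        Real.norm_eq_abs, abs_of_nonneg (le_max_right _ _)]
      exact max_le (le_abs_self _) (abs_nonneg _)
    rw [charFun_apply, charFun_apply,
      integral_withDensity_eq_integral_toReal_smul hGm.ennreal_ofReal (by simp),
      integral_withDensity_eq_integral_toReal_smul hGn.ennreal_ofReal (by simp),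
      ← sub_eq_zero, ← integral_sub (hb G hGi) (hb (fun x => -G x) hGi.neg), ← integral_char_mul_eq_zero hg ξ]
    congr 1
    funext x
    rw [← sub_smul, ENNReal.toReal_ofReal', ENNReal.toReal_ofReal', Complex.real_smul]
    congr 2
    rcases le_total 0 (G x) with h | h
    · rw [max_eq_left h, max_eq_right (by linarith)]; simp [hG]
    · rw [max_eq_right h, max_eq_left (by linarith)]; simp [hG]
  rw [withDensity_eq_iff hGm.ennreal_ofReal.aemeasurable hGn.ennreal_ofReal.aemeasurable
    hGi.lintegral_lt_top.ne] at key
  rw [Lp.eq_zero_iff_ae_eq_zero]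
  filter_upwards [key] with x hx
  have h0 : G x = 0 := by
    rcases le_total 0 (G x) with h | h
    · rw [ENNReal.ofReal_of_nonpos (by simpa using h : -G x ≤ 0)] at hx
      exact le_antisymm (ENNReal.ofReal_eq_zero.1 hx) h
    · rw [ENNReal.ofReal_of_nonpos h] at hx
      have := ENNReal.ofReal_eq_zero.1 hx.symm
      linarith
  have h1 : hermiteS (0 : Fin d → ℕ) x ≠ 0 := by
    change hermiteFun 0 x ≠ 0
    rw [hermiteFun_zero]
    have : 0 < Real.sqrt (Real.sqrt Real.pi) := Real.sqrt_pos.2 (Real.sqrt_pos.2 Real.pi_pos)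
    positivity
  exact (mul_eq_zero.1 h0).resolve_left h1

/-- The Hermite functions as a Hilbert basis of `L²(ℝ^d)`. -/
def hermiteBasis (d : ℕ) : HilbertBasis (Fin d → ℕ) ℝ (Lp ℝ 2 (volume : Measure (Euc d))) :=
  HilbertBasis.mkOfOrthogonalEqBot orthonormal_hermiteS (by
    rw [Submodule.eq_bot_iff]
    intro g hg
    refine eq_zero_of_forall_inner_hermiteS fun k => ?_
    exact (Submodule.mem_orthogonal _ _).1 hg _ (Submodule.subset_span ⟨k, rfl⟩))

theorem hermiteBasis_apply (k : Fin d → ℕ) :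
    hermiteBasis d k = (hermiteS k).toLp 2 (volume : Measure (Euc d)) := by
  rw [hermiteBasis, HilbertBasis.coe_mkOfOrthogonalEqBot]

/-- Parseval's identity for Schwartz functions. -/
theorem hasSum_integral_hermiteS_mul (f g : 𝓢(Euc d, ℝ)) :
    HasSum (fun k : Fin d → ℕ => (∫ x, f x * hermiteS k x) * ∫ x, hermiteS k x * g x)
      (∫ x, f x * g x) := by
  have h := (hermiteBasis d).hasSum_inner_mul_inner (f.toLp 2 volume) (g.toLp 2 volume)
  simpa only [hermiteBasis_apply, inner_toL2] using h

end

section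

variable {d : ℕ}

/-! ### Hermite coefficients of Schwartz functions -/

/-- The Hermite coefficient `⟨h_k, f⟩` of a Schwartz function. -/
def coef (f : 𝓢(Euc d, ℝ)) (k : Fin d → ℕ) : ℝ := ∫ x, hermiteS k x * f x

theorem coef_eq_inner (f : 𝓢(Euc d, ℝ)) (k : Fin d → ℕ) :
    coef f k = inner ℝ (hermiteBasis d k) (f.toLp 2 volume) := by
  rw [hermiteBasis_apply, inner_toL2, coef]

theorem coef_hermiteS (k m : Fin d → ℕ) : coef (hermiteS m) k = if k = m then 1 else 0 :=
  integral_hermiteS_mul k m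

theorem coef_add (f g : 𝓢(Euc d, ℝ)) (k : Fin d → ℕ) : coef (f + g) k = coef f k + coef g k := by
  simp only [coef_eq_inner, ← SchwartzMap.toLpCLM_apply (𝕜 := ℝ), map_add, inner_add_right]

theorem coef_smul (c : ℝ) (f : 𝓢(Euc d, ℝ)) (k : Fin d → ℕ) : coef (c • f) k = c * coef f k := by
  simp only [coef_eq_inner, ← SchwartzMap.toLpCLM_apply (𝕜 := ℝ), map_smul, inner_smul_right]

theorem coef_harmonic (f : 𝓢(Euc d, ℝ)) (k : Fin d → ℕ) :
    coef (harmonic d f) k = hermiteEig k * coef f k := by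
  rw [coef, ← integral_harmonic_mul, harmonic_hermiteS, coef, ← integral_const_mul]
  congr 1; ext x
  simp [mul_assoc]

theorem coef_harmonic_pow (n : ℕ) (f : 𝓢(Euc d, ℝ)) (k : Fin d → ℕ) :
    coef ((harmonic d ^ n) f) k = hermiteEig k ^ n * coef f k := by
  induction n with
  | zero => simp
  | succ n ih =>
    rw [pow_succ', mul_apply_eq_comp, coef_harmonic, ih]
    ring

theorem hasSum_coef_sq (f : 𝓢(Euc d, ℝ)) :
    HasSum (fun k => coef f k ^ 2) (‖f.toLp 2 (volume : Measure (Euc d))‖ ^ 2) := by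
  have h := (hermiteBasis d).hasSum_inner_mul_inner (f.toLp 2 volume) (f.toLp 2 volume)
  rw [real_inner_self_eq_norm_sq] at h
  refine h.congr_fun fun k => ?_
  rw [real_inner_comm, coef_eq_inner, sq]

theorem one_le_hermiteEig [NeZero d] (k : Fin d → ℕ) : 1 ≤ hermiteEig k := by
  have : (1 : ℝ) ≤ d := by exact_mod_cast Nat.pos_of_ne_zero (NeZero.ne d)
  have h2 : (0 : ℝ) ≤ 2 * (∑ j, k j : ℕ) := by positivity
  unfold hermiteEig
  linarith

/-- Applying the harmonic oscillator `n` times dominates the weight of `𝓢_p` for `p ≤ n`, so that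
the `𝓢_p`-norm of a Schwartz function is bounded by an `L²`-norm. -/
theorem rpow_mul_coef_sq_le [NeZero d] {p : ℝ} {n : ℕ} (hn : p ≤ n) (f : 𝓢(Euc d, ℝ))
    (k : Fin d → ℕ) :
    hermiteEig k ^ (2 * p) * coef f k ^ 2 ≤ coef ((harmonic d ^ n) f) k ^ 2 := by
  rw [coef_harmonic_pow, mul_pow]
  refine mul_le_mul_of_nonneg_right ?_ (sq_nonneg _)
  rw [← pow_mul, ← Real.rpow_natCast]
  refine Real.rpow_le_rpow_of_exponent_le (one_le_hermiteEig k) ?_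
  push_cast
  linarith

/-- The regular distribution given by a Schwartz function. -/
def schwartzTD (g : 𝓢(Euc d, ℝ)) : TD d :=
  SchwartzMap.integralCLM ℝ (volume : Measure (Euc d)) ∘L
    SchwartzMap.pairing (ContinuousLinearMap.mul ℝ ℝ) g

theorem schwartzTD_apply (g f : 𝓢(Euc d, ℝ)) : schwartzTD g f = ∫ x, g x * f x := by
  rw [schwartzTD, ContinuousLinearMap.comp_apply, SchwartzMap.integralCLM_apply]
  rfl

theorem schwartzTD_hermiteS (g : 𝓢(Euc d, ℝ)) (k : Fin d → ℕ) :
    schwartzTD g (hermiteS k) = coef g k := by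
  rw [schwartzTD_apply, coef]
  congr 1; ext x; ring

theorem schwartzTD_mem [NeZero d] (p : ℝ) (g : 𝓢(Euc d, ℝ)) : schwartzTD g ∈ spSubmodule d p := by
  refine ⟨fun f => ?_, ?_⟩
  · simp only [schwartzTD_apply]
    exact hasSum_integral_hermiteS_mul g f
  · obtain ⟨n, hn⟩ := exists_nat_ge p
    simp only [schwartzTD_hermiteS]
    refine Summable.of_nonneg_of_le (fun k => ?_) (rpow_mul_coef_sq_le hn g)
      (hasSum_coef_sq _).summable
    have := hermiteEig_nonneg k
    positivity

/-- The element of `𝓢_p` given by a tempered distribution in the underlying submodule. -/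
def Sp.mk {p : ℝ} (u : TD d) (h : u ∈ spSubmodule d p) : Sp d p := ⟨u, h⟩

@[simp] theorem Sp.toTD_mk {p : ℝ} (u : TD d) (h : u ∈ spSubmodule d p) : (Sp.mk u h).toTD = u := rfl

theorem Sp.toLp_apply {p : ℝ} (u : Sp d p) (k : Fin d → ℕ) :
    u.toLp k = hermiteEig k ^ p * u.toTD (hermiteS k) := rfl

theorem Sp.hasSum_toTD {p : ℝ} (u : Sp d p) (f : 𝓢(Euc d, ℝ)) :
    HasSum (fun k => u.toTD (hermiteS k) * coef f k) (u.toTD f) := u.2.1 f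

theorem Sp.norm_eq [NeZero d] {p : ℝ} (u : Sp d p) : ‖u‖ = ‖u.toLp‖ := rfl

theorem Sp.norm_sq_eq_toLp [NeZero d] {p : ℝ} (u : Sp d p) : ‖u‖ ^ 2 = inner ℝ u.toLp u.toLp := by
  rw [real_inner_self_eq_norm_sq, Sp.norm_eq]

/-! ### The Schwartz space inside `𝓢_p` -/

/-- The inclusion of the Schwartz space into `𝓢_p`, as a linear map. -/
def embedLM [NeZero d] (p : ℝ) : 𝓢(Euc d, ℝ) →ₗ[ℝ] Sp d p where
  toFun g := Sp.mk (schwartzTD g) (schwartzTD_mem p g)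
  map_add' f g := by
    apply Sp.toTD_injective
    rw [map_add]
    simp only [Sp.toTD_mk, schwartzTD, map_add, ContinuousLinearMap.comp_add]
  map_smul' c f := by
    apply Sp.toTD_injective
    rw [map_smul]
    simp only [Sp.toTD_mk, schwartzTD, map_smul, ContinuousLinearMap.comp_smul, RingHom.id_apply]

theorem toTD_embedLM [NeZero d] (p : ℝ) (g : 𝓢(Euc d, ℝ)) : (embedLM p g).toTD = schwartzTD g := rfl

theorem norm_embedLM_le [NeZero d] {p : ℝ} {n : ℕ} (hn : p ≤ n) (g : 𝓢(Euc d, ℝ)) :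
    ‖embedLM p g‖ ≤ ‖((harmonic d ^ n) g).toLp 2 (volume : Measure (Euc d))‖ := by
  refine (sq_le_sq₀ (norm_nonneg _) (norm_nonneg _)).1 ?_
  rw [Sp.norm_sq_eq, ← (hasSum_coef_sq _).tsum_eq]
  simp only [toTD_embedLM, schwartzTD_hermiteS]
  refine Summable.tsum_le_tsum (rpow_mul_coef_sq_le hn g) ?_ (hasSum_coef_sq _).summable
  have := (schwartzTD_mem p g).2
  simpa only [schwartzTD_hermiteS] using this

/-- The continuous inclusion of the Schwartz space into `𝓢_p`. -/
def embed [NeZero d] (p : ℝ) : 𝓢(Euc d, ℝ) →L[ℝ] Sp d p where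
  toLinearMap := embedLM p
  cont := by
    obtain ⟨n, hn⟩ := exists_nat_ge p
    refine continuous_of_continuousAt_zero (embedLM p) ?_
    have h : Continuous fun g : 𝓢(Euc d, ℝ) =>
        ‖((harmonic d ^ n) g).toLp 2 (volume : Measure (Euc d))‖ :=
      (SchwartzMap.continuous_toLp.comp (harmonic d ^ n).continuous).norm
    rw [ContinuousAt, map_zero]
    refine squeeze_zero_norm (norm_embedLM_le hn) ?_
    have h0 := h.tendsto 0
    have h1 : ‖((harmonic d ^ n) (0 : 𝓢(Euc d, ℝ))).toLp 2 (volume : Measure (Euc d))‖ = 0 := by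
      rw [map_zero, ← SchwartzMap.toLpCLM_apply (𝕜 := ℝ), map_zero, norm_zero]
    rwa [h1] at h0

variable [NeZero d] {p q : ℝ}

@[simp] theorem toTD_embed_apply (g f : 𝓢(Euc d, ℝ)) :
    (embed p g).toTD f = ∫ x, g x * f x := schwartzTD_apply g f

theorem toTD_embed_hermiteS (g : 𝓢(Euc d, ℝ)) (k : Fin d → ℕ) :
    (embed p g).toTD (hermiteS k) = coef g k := schwartzTD_hermiteS g k

theorem toLp_embed (g : 𝓢(Euc d, ℝ)) (k : Fin d → ℕ) :
    (embed p g).toLp k = hermiteEig k ^ p * coef g k := by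
  rw [Sp.toLp_apply, toTD_embed_hermiteS]

/-- The duality between `𝓢_p` and `𝓢_{-p}`. -/
theorem Sp.toTD_eq_inner (u : Sp d p) (f : 𝓢(Euc d, ℝ)) :
    u.toTD f = inner ℝ u.toLp (embed (-p) f).toLp := by
  refine (u.hasSum_toTD f).unique ((lp.hasSum_inner _ _).congr_fun fun k => ?_)
  rw [toLp_embed, Sp.toLp_apply]
  have := Real.rpow_pos_of_pos (hermiteEig_pos k) p
  rw [Real.rpow_neg (hermiteEig_nonneg k)]
  simp
  field_simp

theorem Sp.abs_toTD_le (u : Sp d p) (f : 𝓢(Euc d, ℝ)) :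
    |u.toTD f| ≤ ‖u‖ * ‖embed (-p) f‖ := by
  rw [Sp.toTD_eq_inner]
  exact abs_real_inner_le_norm _ _

/-- Evaluation at a Schwartz function, as a continuous linear functional on `𝓢_p`. -/
def evalCLM (p : ℝ) (f : 𝓢(Euc d, ℝ)) : Sp d p →L[ℝ] ℝ :=
  LinearMap.mkContinuous
    { toFun := fun u => u.toTD f
      map_add' := fun u v => by simp
      map_smul' := fun c u => by simp } ‖embed (-p) f‖ fun u => by
    rw [mul_comm]; exact u.abs_toTD_le f

@[simp] theorem evalCLM_apply (f : 𝓢(Euc d, ℝ)) (u : Sp d p) : evalCLM p f u = u.toTD f := rfl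

/-- The coordinate map as a linear isometry. -/
def toLpLI (d : ℕ) [NeZero d] (p : ℝ) : Sp d p →ₗᵢ[ℝ] lp (fun _ : Fin d → ℕ => ℝ) 2 where
  toLinearMap := Sp.toLp
  norm_map' _ := rfl

@[simp] theorem toLpLI_apply (u : Sp d p) : toLpLI d p u = u.toLp := rfl

/-- The tempered distribution with given square summable coordinates in `𝓢_p`. -/
def ofLpTD (p : ℝ) (c : lp (fun _ : Fin d → ℕ => ℝ) 2) : TD d :=
  (innerSL ℝ c) ∘L ((toLpLI d (-p)).toContinuousLinearMap ∘L embed (-p))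

theorem hasSum_ofLpTD (c : lp (fun _ : Fin d → ℕ => ℝ) 2) (f : 𝓢(Euc d, ℝ)) :
    HasSum (fun k => hermiteEig k ^ (-p) * c k * coef f k) (ofLpTD p c f) := by
  refine (lp.hasSum_inner c (embed (-p) f).toLp).congr_fun fun k => ?_
  rw [toLp_embed]
  simp
  ring

theorem ofLpTD_hermiteS (c : lp (fun _ : Fin d → ℕ => ℝ) 2) (k : Fin d → ℕ) :
    ofLpTD p c (hermiteS k) = hermiteEig k ^ (-p) * c k := by
  refine (hasSum_ofLpTD c (hermiteS k)).unique ?_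
  convert! hasSum_ite_eq k (hermiteEig k ^ (-p) * c k) using 1
  funext m
  rw [coef_hermiteS]
  split_ifs with h
  · rw [h, mul_one]
  · rw [mul_zero]

theorem rpow_mul_ofLpTD (c : lp (fun _ : Fin d → ℕ => ℝ) 2) (k : Fin d → ℕ) :
    hermiteEig k ^ p * ofLpTD p c (hermiteS k) = c k := by
  rw [ofLpTD_hermiteS, ← mul_assoc, ← Real.rpow_add (hermiteEig_pos k)]
  simp

theorem ofLpTD_mem (c : lp (fun _ : Fin d → ℕ => ℝ) 2) : ofLpTD p c ∈ spSubmodule d p := by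
  refine ⟨fun f => ?_, ?_⟩
  · simp only [ofLpTD_hermiteS]
    exact hasSum_ofLpTD c f
  · rw [← memlp_coord_iff]
    have : coord p (ofLpTD p c) = c := funext fun k => rpow_mul_ofLpTD c k
    rw [this]
    exact lp.memℓp c

theorem toLpLI_surjective : Function.Surjective (toLpLI d p) := fun c =>
  ⟨Sp.mk _ (ofLpTD_mem c), by ext k; exact rpow_mul_ofLpTD c k⟩

/-- `𝓢_p` is isometric to `ℓ²`. -/
def toLpEquiv (d : ℕ) [NeZero d] (p : ℝ) : Sp d p ≃ₗᵢ[ℝ] lp (fun _ : Fin d → ℕ => ℝ) 2 :=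
  LinearIsometryEquiv.ofSurjective (toLpLI d p) toLpLI_surjective

@[simp] theorem toLpEquiv_apply (u : Sp d p) : toLpEquiv d p u = u.toLp := rfl

instance : CompleteSpace (Sp d p) :=
  (toLpEquiv d p).isometry.isUniformInducing.completeSpace_congr (toLpEquiv d p).surjective |>.2
    inferInstance

/-- The Hermite expansion in `𝓢_p`. -/
theorem Sp.hasSum_hermite (u : Sp d p) :
    HasSum (fun k => u.toTD (hermiteS k) • embed p (hermiteS k)) u := by
  have h := (lp.hasSum_single (p := 2) (by simp) (u.toLp)).mapL
    ((toLpEquiv d p).symm : lp (fun _ : Fin d → ℕ => ℝ) 2 →L[ℝ] Sp d p)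
  have h1 : ((toLpEquiv d p).symm : lp (fun _ : Fin d → ℕ => ℝ) 2 →L[ℝ] Sp d p) u.toLp = u :=
    (toLpEquiv d p).symm_apply_apply u
  rw [h1] at h
  refine h.congr_fun fun k => ?_
  change _ = (toLpEquiv d p).symm _
  rw [LinearIsometryEquiv.eq_symm_apply, map_smul]
  ext m
  rw [lp.coeFn_smul, Pi.smul_apply, toLpEquiv_apply, toLp_embed, coef_hermiteS, lp.single_apply,
    Sp.toLp_apply]
  by_cases hmk : m = k
  · subst hmk
    simp
    ring
  · simp [hmk]

theorem denseRange_embed : DenseRange (embed p : 𝓢(Euc d, ℝ) →L[ℝ] Sp d p) := by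
  intro u
  refine mem_closure_of_tendsto u.hasSum_hermite (Eventually.of_forall fun s => ?_)
  exact ⟨∑ k ∈ s, u.toTD (hermiteS k) • hermiteS k, by simp only [map_sum, map_smul]⟩

/-- An operator on the Schwartz space which has a formal adjoint and is bounded from `𝓢_p` to
`𝓢_q` extends to `𝓢_p`, where it acts on distributions by duality. -/
theorem exists_extension (L L' : 𝓢(Euc d, ℝ) →L[ℝ] 𝓢(Euc d, ℝ))
    (hadj : ∀ f g, ∫ x, L f x * g x = ∫ x, f x * L' g x) {C : ℝ} (hC : 0 ≤ C)
    (h : ∀ f, ‖embed q (L f)‖ ≤ C * ‖embed p f‖) :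
    ∃ Λ : Sp d p →L[ℝ] Sp d q, ‖Λ‖ ≤ C ∧ (∀ f, Λ (embed p f) = embed q (L f)) ∧
      ∀ u, (Λ u).toTD = u.toTD ∘L L' := by
  obtain ⟨Λ, hΛ, hΛe⟩ : ∃ Λ : Sp d p →L[ℝ] Sp d q, ‖Λ‖ ≤ C ∧
      ∀ f, Λ (embedLM p f) = embedLM q (L f) := by
    have hd : DenseRange (embedLM p : 𝓢(Euc d, ℝ) →ₗ[ℝ] Sp d p) := denseRange_embed
    have h' : ∀ f, ‖((embedLM q) ∘ₗ (L : 𝓢(Euc d, ℝ) →ₗ[ℝ] 𝓢(Euc d, ℝ))) f‖ ≤ C * ‖embedLM p f‖ := h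
    exact ⟨_, LinearMap.opNorm_extendOfNorm_le hd hC h', LinearMap.extendOfNorm_eq hd ⟨C, h'⟩⟩
  refine ⟨Λ, hΛ, hΛe, fun u => ?_⟩
  ext g
  have h1 : Continuous fun u : Sp d p => (Λ u).toTD g := (evalCLM q g).continuous.comp Λ.continuous
  have h2 : Continuous fun u : Sp d p => u.toTD (L' g) := (evalCLM p (L' g)).continuous
  refine congrFun (denseRange_embed.equalizer h1 h2 (funext fun f => ?_)) u
  change (Λ (embedLM p f)).toTD g = (embed p f).toTD (L' g)
  rw [hΛe, toTD_embed_apply, ← hadj]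
  exact toTD_embed_apply (p := q) (L f) g

end

section

open LineDeriv Laplacian

/-! ### Comparison of neighbouring weights -/

theorem rpow_le_rpow_add_two {w : ℝ} (hw : 1 ≤ w) (r : ℝ) :
    w ^ r ≤ 3 ^ |r| * (w + 2) ^ r := by
  have h0 : 0 < w := by linarith
  rcases le_total 0 r with hr | hr
  · have h1 : w ^ r ≤ (w + 2) ^ r := Real.rpow_le_rpow h0.le (by linarith) hr
    have h2 : (1 : ℝ) ≤ 3 ^ |r| := Real.one_le_rpow (by norm_num) (abs_nonneg r)
    have h3 : 0 ≤ (w + 2) ^ r := by positivity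
    nlinarith
  · have h1 : (3 * w) ^ r ≤ (w + 2) ^ r :=
      Real.rpow_le_rpow_of_nonpos (by linarith) (by linarith) hr
    rw [Real.mul_rpow (by norm_num) h0.le] at h1
    have h2 : (3 : ℝ) ^ |r| * 3 ^ r = 1 := by
      rw [abs_of_nonpos hr, ← Real.rpow_add (by norm_num)]; simp
    calc w ^ r = 3 ^ |r| * (3 ^ r * w ^ r) := by rw [← mul_assoc, h2, one_mul]
      _ ≤ _ := by gcongr

theorem rpow_add_two_le {w : ℝ} (hw : 1 ≤ w) (r : ℝ) :
    (w + 2) ^ r ≤ 3 ^ |r| * w ^ r := by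
  have h0 : 0 < w := by linarith
  have h := rpow_le_rpow_add_two hw (-r)
  rw [abs_neg, Real.rpow_neg h0.le, Real.rpow_neg (by linarith)] at h
  have h1 : 0 < w ^ r := by positivity
  have h2 : 0 < (w + 2) ^ r := by positivity
  rwa [inv_eq_one_div, div_le_iff₀ h1, mul_assoc, inv_mul_eq_div, mul_div_assoc', le_div_iff₀ h2,
    one_mul] at h

theorem abs_exp_sub_one_le_mul_exp (y : ℝ) : |Real.exp y - 1| ≤ |y| * Real.exp |y| := by
  rcases le_total 0 y with hy | hy
  · rw [abs_of_nonneg hy, abs_of_nonneg (by linarith [Real.add_one_le_exp y])]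
    have h := Real.add_one_le_exp (-y)
    have h1 : Real.exp y * Real.exp (-y) = 1 := by rw [← Real.exp_add]; simp
    nlinarith [Real.exp_pos y]
  · rw [abs_of_nonpos hy, abs_of_nonpos (by linarith [Real.exp_le_one_iff.2 hy])]
    have h := Real.add_one_le_exp y
    have h1 : 1 ≤ Real.exp (-y) := Real.one_le_exp (by linarith)
    nlinarith

/-- The first-order difference of the weights `w ^ (2 p)` gains a full power of `w`. -/
theorem abs_rpow_add_two_sub_le {w : ℝ} (hw : 1 ≤ w) (p : ℝ) :
    |(w + 2) ^ (2 * p) - w ^ (2 * p)| * Real.sqrt (w + 2) ≤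
      (8 * |p| * Real.exp (4 * |p|) * 3 ^ |p|) * (w ^ p * (w + 2) ^ p) := by
  have h0 : 0 < w := by linarith
  set y : ℝ := 2 * p * Real.log (1 + 2 / w) with hy
  have hl0 : 0 ≤ Real.log (1 + 2 / w) := Real.log_nonneg (by have : 0 < 2 / w := by positivity
                                                             linarith)
  have hl : Real.log (1 + 2 / w) ≤ 2 / w := by
    have := Real.log_le_sub_one_of_pos (x := 1 + 2 / w) (by positivity)
    linarith
  have e1 : (w + 2) ^ (2 * p) = w ^ (2 * p) * Real.exp y := by
    have : w + 2 = w * (1 + 2 / w) := by field_simp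
    rw [this, Real.mul_rpow h0.le (by positivity), Real.rpow_def_of_pos (by positivity : 0 < 1 + 2 / w), hy]
    congr 2
    ring
  have hy1 : |y| ≤ 4 * |p| / w := by
    rw [hy, abs_mul, abs_mul, abs_of_nonneg hl0, abs_two]
    calc 2 * |p| * Real.log (1 + 2 / w) ≤ 2 * |p| * (2 / w) := by gcongr
      _ = _ := by ring
  have hy2 : |y| ≤ 4 * |p| := hy1.trans (div_le_self (by positivity) hw)
  have h1 : |Real.exp y - 1| ≤ 4 * |p| / w * Real.exp (4 * |p|) :=
    (abs_exp_sub_one_le_mul_exp y).trans (by gcongr)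
  have h2 : Real.sqrt (w + 2) ≤ 2 * w := by
    rw [Real.sqrt_le_left (by linarith)]; nlinarith
  have h3 : w ^ (2 * p) = w ^ p * w ^ p := by rw [two_mul, Real.rpow_add h0]
  have h4 := rpow_le_rpow_add_two hw p
  have hp : 0 < w ^ p := by positivity
  rw [e1, show w ^ (2 * p) * Real.exp y - w ^ (2 * p) = w ^ (2 * p) * (Real.exp y - 1) by ring,
    abs_mul, abs_of_nonneg (by positivity : 0 ≤ w ^ (2 * p))]
  calc w ^ (2 * p) * |Real.exp y - 1| * Real.sqrt (w + 2)
      ≤ w ^ (2 * p) * (4 * |p| / w * Real.exp (4 * |p|)) * (2 * w) := by gcongr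
    _ = 8 * |p| * Real.exp (4 * |p|) * (w ^ p * w ^ p) := by rw [h3]; field_simp; ring
    _ ≤ 8 * |p| * Real.exp (4 * |p|) * (w ^ p * (3 ^ |p| * (w + 2) ^ p)) := by gcongr
    _ = _ := by ring

variable {d : ℕ}

/-! ### The lowering and raising operators on the Schwartz space -/

theorem hasTemperateGrowth_coord (j : Fin d) : (fun x : Euc d => x j).HasTemperateGrowth :=
  (EuclideanSpace.proj (𝕜 := ℝ) j).hasTemperateGrowth

/-- The lowering operator `(x_j + ∂_j) / 2`. -/
def lower (j : Fin d) (f : 𝓢(Euc d, ℝ)) : 𝓢(Euc d, ℝ) :=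
  (1 / 2 : ℝ) • (SchwartzMap.smulLeftCLM ℝ (fun x : Euc d => x j) f + ∂_{basisVec j} f)

/-- The raising operator `(x_j - ∂_j) / 2`. -/
def raise (j : Fin d) (f : 𝓢(Euc d, ℝ)) : 𝓢(Euc d, ℝ) :=
  (1 / 2 : ℝ) • (SchwartzMap.smulLeftCLM ℝ (fun x : Euc d => x j) f - ∂_{basisVec j} f)

theorem lower_sub_raise (j : Fin d) (f : 𝓢(Euc d, ℝ)) :
    lower j f - raise j f = ∂_{basisVec j} f := by
  rw [lower, raise]
  module

theorem coef_lineDeriv (j : Fin d) (f : 𝓢(Euc d, ℝ)) (k : Fin d → ℕ) :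
    coef (∂_{basisVec j} f) k = -∫ x, ∂_{basisVec j} (hermiteS k) x * f x :=
  SchwartzMap.integral_mul_lineDerivOp_right_eq_neg_left (hermiteS k) f (basisVec j)
    (μ := volume)

theorem coef_coord_mul (j : Fin d) (f : 𝓢(Euc d, ℝ)) (k : Fin d → ℕ) :
    coef (SchwartzMap.smulLeftCLM ℝ (fun x : Euc d => x j) f) k =
      ∫ x : Euc d, (x j * hermiteS k x) * f x := by
  rw [coef]
  congr 1; ext x
  rw [SchwartzMap.smulLeftCLM_apply_apply (hasTemperateGrowth_coord j), smul_eq_mul]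
  ring

theorem coef_neg (f : 𝓢(Euc d, ℝ)) (k : Fin d → ℕ) : coef (-f) k = -coef f k := by
  rw [← neg_one_smul ℝ f, coef_smul, neg_one_mul]

theorem coef_lower (j : Fin d) (f : 𝓢(Euc d, ℝ)) (k : Fin d → ℕ) :
    coef (lower j f) k = Real.sqrt (((k j : ℝ) + 1) / 2) * coef f (up j k) := by
  rw [lower, coef_smul, coef_add, coef_lineDeriv, coef_coord_mul, ← sub_eq_add_neg,
    ← integral_sub (integrable_coord_mul _ _ _) (integrable_schwartz_mul _ _), coef,
    ← integral_const_mul, ← integral_const_mul]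
  congr 1; ext x
  rw [← sub_mul, raise_hermiteS]
  ring

theorem coef_raise (j : Fin d) (f : 𝓢(Euc d, ℝ)) (k : Fin d → ℕ) :
    coef (raise j f) k = Real.sqrt ((k j : ℝ) / 2) * coef f (dn j k) := by
  rw [raise, coef_smul, sub_eq_add_neg, coef_add, coef_neg, coef_lineDeriv, coef_coord_mul, neg_neg,
    ← integral_add (integrable_coord_mul _ _ _) (integrable_schwartz_mul _ _), coef,
    ← integral_const_mul, ← integral_const_mul]
  congr 1; ext x
  rw [← add_mul, lower_hermiteS]
  ring

theorem sqrt_le_hermiteEig (j : Fin d) (k : Fin d → ℕ) :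
    Real.sqrt (((k j : ℝ) + 1) / 2) ≤ Real.sqrt (hermiteEig k + 2) := by
  refine Real.sqrt_le_sqrt ?_
  have h1 : k j ≤ ∑ i, k i := Finset.single_le_sum (fun _ _ => Nat.zero_le _) (Finset.mem_univ j)
  have h2 : (k j : ℝ) ≤ (∑ i, k i : ℕ) := by exact_mod_cast h1
  have h3 : (0 : ℝ) ≤ d := by positivity
  have h4 : (0 : ℝ) ≤ k j := by positivity
  unfold hermiteEig
  linarith

variable [NeZero d] {p q : ℝ}

/-- The inner product `⟨f, g⟩_p` of `𝓢_p`, on Schwartz functions. -/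
def ip (p : ℝ) (f g : 𝓢(Euc d, ℝ)) : ℝ := inner ℝ (embed p f).toLp (embed p g).toLp

theorem hasSum_ip (p : ℝ) (f g : 𝓢(Euc d, ℝ)) :
    HasSum (fun k => hermiteEig k ^ (2 * p) * coef f k * coef g k) (ip p f g) := by
  refine (lp.hasSum_inner (embed p f).toLp (embed p g).toLp).congr_fun fun k => ?_
  rw [toLp_embed, toLp_embed, two_mul, Real.rpow_add (hermiteEig_pos k)]
  simp
  ring

theorem ip_self (f : 𝓢(Euc d, ℝ)) : ip p f f = ‖embed p f‖ ^ 2 :=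
  (Sp.norm_sq_eq_toLp _).symm

theorem ip_comm (f g : 𝓢(Euc d, ℝ)) : ip p f g = ip p g f := real_inner_comm _ _

theorem ip_sub_left (f f' g : 𝓢(Euc d, ℝ)) : ip p (f - f') g = ip p f g - ip p f' g := by
  rw [ip, map_sub, map_sub, inner_sub_left, ip, ip]

theorem hasSum_norm_sq (p : ℝ) (f : 𝓢(Euc d, ℝ)) :
    HasSum (fun k => hermiteEig k ^ (2 * p) * coef f k ^ 2) (‖embed p f‖ ^ 2) := by
  rw [← ip_self]
  refine (hasSum_ip p f f).congr_fun fun k => ?_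
  ring

/-- The series of `⟨f, a_j† g⟩_p`, with the index shifted so that only the coefficients
`f_{k + e_j}` and `g_k` occur, as in the series of `⟨a_j f, g⟩_p`. -/
theorem hasSum_ip_raise (j : Fin d) (p : ℝ) (f g : 𝓢(Euc d, ℝ)) :
    HasSum (fun k => hermiteEig (up j k) ^ (2 * p) * coef f (up j k) *
      (Real.sqrt (((k j : ℝ) + 1) / 2) * coef g k)) (ip p f (raise j g)) := by
  have h := (Function.Injective.hasSum_iff (up_injective j) (fun k hk => by
    have h0 : k j = 0 := by
      by_contra h0
      exact hk ⟨dn j k, up_dn h0⟩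
    rw [coef_raise, h0]
    simp)).2 (hasSum_ip p f (raise j g))
  refine h.congr_fun fun k => ?_
  simp only [Function.comp_apply, coef_raise, dn_up, up_same]
  push_cast
  rfl

/-- The lowering and raising operators are adjoint to each other in `𝓢_p` up to a bounded form:
both sides are series in `f_{k + e_j} g_k`, with weights that differ by a first-order difference.
The free parameter `ε` replaces the product of the norms by a weighted sum of squares. -/
theorem abs_ip_lower_sub_le (j : Fin d) (p : ℝ) (f g : 𝓢(Euc d, ℝ)) {ε : ℝ} (hε : 0 < ε) :
    |ip p (lower j f) g - ip p f (raise j g)| ≤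
      (8 * |p| * Real.exp (4 * |p|) * 3 ^ |p|) * (ε * ‖embed p f‖ ^ 2 + ε⁻¹ * ‖embed p g‖ ^ 2) := by
  set C : ℝ := 8 * |p| * Real.exp (4 * |p|) * 3 ^ |p| with hC
  have hC0 : 0 ≤ C := by positivity
  have h1 := (hasSum_ip p (lower j f) g).sub (hasSum_ip_raise j p f g)
  have hf : Summable fun k => hermiteEig (up j k) ^ (2 * p) * coef f (up j k) ^ 2 :=
    (hasSum_norm_sq p f).summable.comp_injective (up_injective j)
  have hf' : ∑' k, hermiteEig (up j k) ^ (2 * p) * coef f (up j k) ^ 2 ≤ ‖embed p f‖ ^ 2 := by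
    rw [← (hasSum_norm_sq p f).tsum_eq]
    exact tsum_comp_le_tsum_of_inj (hasSum_norm_sq p f).summable (fun k => by
      have := hermiteEig_nonneg k
      positivity) (up_injective j)
  have hg := hasSum_norm_sq p g
  have h2 := ((hf.hasSum.mul_left ε).add (hg.mul_left ε⁻¹)).mul_left C
  have h3 : ∀ k : Fin d → ℕ, ‖hermiteEig k ^ (2 * p) * coef (lower j f) k * coef g k -
      hermiteEig (up j k) ^ (2 * p) * coef f (up j k) * (Real.sqrt (((k j : ℝ) + 1) / 2) * coef g k)‖ ≤
      C * (ε * (hermiteEig (up j k) ^ (2 * p) * coef f (up j k) ^ 2) +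
        ε⁻¹ * (hermiteEig k ^ (2 * p) * coef g k ^ 2)) := by
    intro k
    have hw := one_le_hermiteEig k
    have hw0 := hermiteEig_pos k
    rw [hermiteEig_up, coef_lower]
    have e : hermiteEig k ^ (2 * p) * (Real.sqrt (((k j : ℝ) + 1) / 2) * coef f (up j k)) * coef g k
      - (hermiteEig k + 2) ^ (2 * p) * coef f (up j k) * (Real.sqrt (((k j : ℝ) + 1) / 2) * coef g k)
      = -(((hermiteEig k + 2) ^ (2 * p) - hermiteEig k ^ (2 * p)) * Real.sqrt (((k j : ℝ) + 1) / 2)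
        * (coef f (up j k) * coef g k)) := by ring
    rw [e, norm_neg, norm_mul, norm_mul, Real.norm_eq_abs, Real.norm_eq_abs, Real.norm_eq_abs,
      abs_of_nonneg (Real.sqrt_nonneg _), abs_mul]
    have h4 : |(hermiteEig k + 2) ^ (2 * p) - hermiteEig k ^ (2 * p)| *
        Real.sqrt (((k j : ℝ) + 1) / 2) ≤ C * (hermiteEig k ^ p * (hermiteEig k + 2) ^ p) :=
      (mul_le_mul_of_nonneg_left (sqrt_le_hermiteEig j k) (abs_nonneg _)).trans
        (abs_rpow_add_two_sub_le hw p)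
    refine (mul_le_mul_of_nonneg_right h4 (by positivity)).trans ?_
    rw [mul_assoc]
    refine mul_le_mul_of_nonneg_left ?_ hC0
    rw [two_mul, Real.rpow_add hw0, Real.rpow_add (by linarith)]
    set u := (hermiteEig k + 2) ^ p * |coef f (up j k)| with hu
    set v := hermiteEig k ^ p * |coef g k| with hv
    have e1 : (hermiteEig k + 2) ^ p * (hermiteEig k + 2) ^ p * coef f (up j k) ^ 2 = u ^ 2 := by
      rw [hu, mul_pow, sq_abs]; ring
    have e2 : hermiteEig k ^ p * hermiteEig k ^ p * coef g k ^ 2 = v ^ 2 := by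
      rw [hv, mul_pow, sq_abs]; ring
    rw [e1, e2]
    have e3 : hermiteEig k ^ p * (hermiteEig k + 2) ^ p * (|coef f (up j k)| * |coef g k|) = u * v := by
      rw [hu, hv]; ring
    rw [e3]
    have hu0 : 0 ≤ u := by positivity
    have hv0 : 0 ≤ v := by positivity
    have h5 : 0 ≤ ε⁻¹ * (ε * u - v) ^ 2 := by positivity
    have h6 : ε⁻¹ * (ε * u - v) ^ 2 = ε * u ^ 2 - 2 * (u * v) + ε⁻¹ * v ^ 2 := by
      field_simp
      ring
    have := mul_nonneg hu0 hv0
    linarith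
  have h7 := tsum_of_norm_bounded h2 h3
  rw [h1.tsum_eq, Real.norm_eq_abs] at h7
  refine h7.trans ?_
  gcongr

/-- The derivative is skew-adjoint in `𝓢_p` up to a bounded form. -/
theorem abs_ip_lineDeriv_add_le (j : Fin d) (p : ℝ) (f g : 𝓢(Euc d, ℝ)) {ε : ℝ} (hε : 0 < ε) :
    |ip p (∂_{basisVec j} f) g + ip p f (∂_{basisVec j} g)| ≤
      2 * (8 * |p| * Real.exp (4 * |p|) * 3 ^ |p|) *
        (ε * ‖embed p f‖ ^ 2 + ε⁻¹ * ‖embed p g‖ ^ 2) := by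
  have h1 := abs_ip_lower_sub_le j p f g hε
  have h2 := abs_ip_lower_sub_le j p g f (inv_pos.2 hε)
  rw [inv_inv] at h2
  rw [← lower_sub_raise, ← lower_sub_raise, ip_sub_left, ip_comm f, ip_sub_left]
  rw [ip_comm g (raise j f)] at h2
  rw [ip_comm f (raise j g)] at h1
  have e : ip p (lower j f) g - ip p (raise j f) g + (ip p (lower j g) f - ip p (raise j g) f) =
    (ip p (lower j f) g - ip p (raise j g) f) + (ip p (lower j g) f - ip p (raise j f) g) := by ring
  rw [e]
  refine (abs_add_le _ _).trans ((add_le_add h1 h2).trans (le_of_eq ?_))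
  ring

/-- The monotonicity inequality for the Laplacian in `𝓢_p`. -/
theorem exists_ip_laplacian_le (d : ℕ) [NeZero d] (p : ℝ) :
    ∃ C : ℝ, 0 ≤ C ∧ ∀ f : 𝓢(Euc d, ℝ), ip p (Δ f) f ≤ C * ‖embed p f‖ ^ 2 := by
  set C : ℝ := 2 * (8 * |p| * Real.exp (4 * |p|) * 3 ^ |p|) with hC
  have hC0 : 0 ≤ C := by positivity
  refine ⟨d * (C * (C + 1)), by positivity, fun f => ?_⟩
  have hj : ∀ j : Fin d, ip p (∂_{basisVec j} (∂_{basisVec j} f : 𝓢(Euc d, ℝ))) f ≤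
      C * (C + 1) * ‖embed p f‖ ^ 2 := by
    intro j
    -- The term `‖∂_j f‖_p²` from the skew form has a favourable sign; `ε = (C + 1)⁻¹` lets it absorb
    -- the part of the error that involves `∂_j f`.
    have h := (abs_le.1 (abs_ip_lineDeriv_add_le j p (∂_{basisVec j} f : 𝓢(Euc d, ℝ)) f
      (ε := (C + 1)⁻¹) (by positivity))).2
    rw [← hC, ip_self, inv_inv] at h
    have h1 : C * (C + 1)⁻¹ ≤ 1 := by
      rw [← div_eq_mul_inv, div_le_one (by positivity)]; linarith
    nlinarith [sq_nonneg ‖embed p (∂_{basisVec j} f : 𝓢(Euc d, ℝ))‖]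
  rw [laplacian_eq_sum_basisVec, ip, map_sum, map_sum, sum_inner]
  refine (Finset.sum_le_sum fun j _ => hj j).trans (le_of_eq ?_)
  rw [Finset.sum_const, Finset.card_univ, Fintype.card_fin, nsmul_eq_mul]
  ring

/-! ### Boundedness of derivatives between the spaces `𝓢_p` -/

theorem half_add_one_le_hermiteEig (j : Fin d) (k : Fin d → ℕ) :
    ((k j : ℝ) + 1) / 2 ≤ hermiteEig k := by
  have h1 : k j ≤ ∑ i, k i := Finset.single_le_sum (fun _ _ => Nat.zero_le _) (Finset.mem_univ j)
  have h2 : (k j : ℝ) ≤ (∑ i, k i : ℕ) := by exact_mod_cast h1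
  have h3 : (1 : ℝ) ≤ d := by exact_mod_cast Nat.pos_of_ne_zero (NeZero.ne d)
  have h4 : (0 : ℝ) ≤ k j := by positivity
  unfold hermiteEig
  linarith

theorem norm_embed_lower_le (j : Fin d) (q : ℝ) (f : 𝓢(Euc d, ℝ)) :
    ‖embed q (lower j f)‖ ^ 2 ≤ 3 ^ |2 * q + 1| * ‖embed (q + 1 / 2) f‖ ^ 2 := by
  have hs := (hasSum_norm_sq (q + 1 / 2) f)
  have hf := hs.summable.comp_injective (up_injective j)
  have hf' := tsum_comp_le_tsum_of_inj hs.summable (fun k => by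
      have := hermiteEig_nonneg k
      positivity) (up_injective j)
  rw [hs.tsum_eq] at hf'
  refine le_trans ?_ (mul_le_mul_of_nonneg_left hf' (by positivity))
  refine hasSum_le (fun k => ?_) (hasSum_norm_sq q (lower j f)) (hf.hasSum.mul_left _)
  have hw := one_le_hermiteEig k
  have hw0 := hermiteEig_pos k
  simp only [Function.comp_apply]
  rw [coef_lower, hermiteEig_up, mul_pow, Real.sq_sqrt (by positivity)]
  have h1 := rpow_le_rpow_add_two hw (2 * q + 1)
  rw [Real.rpow_add hw0, Real.rpow_one] at h1
  have h2 := half_add_one_le_hermiteEig j k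
  rw [show 2 * (q + 1 / 2) = 2 * q + 1 by ring]
  calc hermiteEig k ^ (2 * q) * (((k j : ℝ) + 1) / 2 * coef f (up j k) ^ 2)
      ≤ hermiteEig k ^ (2 * q) * (hermiteEig k * coef f (up j k) ^ 2) := by gcongr
    _ = hermiteEig k ^ (2 * q) * hermiteEig k * coef f (up j k) ^ 2 := by ring
    _ ≤ 3 ^ |2 * q + 1| * (hermiteEig k + 2) ^ (2 * q + 1) * coef f (up j k) ^ 2 := by gcongr
    _ = _ := by ring

theorem norm_embed_raise_le (j : Fin d) (q : ℝ) (f : 𝓢(Euc d, ℝ)) :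
    ‖embed q (raise j f)‖ ^ 2 ≤ 3 ^ |2 * q| * ‖embed (q + 1 / 2) f‖ ^ 2 := by
  have h0 := hasSum_ip_raise j q (raise j f) f
  rw [ip_self] at h0
  refine hasSum_le (fun k => ?_) h0 ((hasSum_norm_sq (q + 1 / 2) f).mul_left _)
  have hw := one_le_hermiteEig k
  have hw0 := hermiteEig_pos k
  rw [coef_raise, hermiteEig_up, dn_up, up_same]
  have h1 := rpow_add_two_le hw (2 * q)
  have h2 := half_add_one_le_hermiteEig j k
  have h3 : Real.sqrt (((k j : ℝ) + 1) / 2) * Real.sqrt (((k j : ℝ) + 1) / 2) = ((k j : ℝ) + 1) / 2 :=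
    Real.mul_self_sqrt (by positivity)
  rw [show 2 * (q + 1 / 2) = 2 * q + 1 by ring, Real.rpow_add hw0, Real.rpow_one]
  push_cast
  calc (hermiteEig k + 2) ^ (2 * q) * (Real.sqrt (((k j : ℝ) + 1) / 2) * coef f k) *
        (Real.sqrt (((k j : ℝ) + 1) / 2) * coef f k)
      = (hermiteEig k + 2) ^ (2 * q) * ((((k j : ℝ) + 1) / 2) * coef f k ^ 2) := by
        linear_combination (hermiteEig k + 2) ^ (2 * q) * coef f k ^ 2 * h3
    _ ≤ (3 ^ |2 * q| * hermiteEig k ^ (2 * q)) * (hermiteEig k * coef f k ^ 2) := by gcongr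
    _ = _ := by ring

/-- A derivative costs half an order in the scale `𝓢_p`. -/
theorem exists_norm_embed_lineDeriv_le (q : ℝ) :
    ∃ C : ℝ, 0 ≤ C ∧ ∀ (j : Fin d) (f : 𝓢(Euc d, ℝ)),
      ‖embed q (∂_{basisVec j} f)‖ ≤ C * ‖embed (q + 1 / 2) f‖ := by
  refine ⟨Real.sqrt (3 ^ |2 * q + 1|) + Real.sqrt (3 ^ |2 * q|), by positivity, fun j f => ?_⟩
  rw [← lower_sub_raise, map_sub, add_mul]
  refine (norm_sub_le _ _).trans (add_le_add ?_ ?_)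
  · rw [← Real.sqrt_sq (norm_nonneg (embed (q + 1 / 2) f)), ← Real.sqrt_mul (by positivity)]
    exact Real.le_sqrt_of_sq_le (norm_embed_lower_le j q f)
  · rw [← Real.sqrt_sq (norm_nonneg (embed (q + 1 / 2) f)), ← Real.sqrt_mul (by positivity)]
    exact Real.le_sqrt_of_sq_le (norm_embed_raise_le j q f)

theorem exists_norm_embed_laplacian_le (d : ℕ) [NeZero d] (p : ℝ) :
    ∃ C : ℝ, 0 ≤ C ∧ ∀ f : 𝓢(Euc d, ℝ), ‖embed (p - 1) (Δ f)‖ ≤ C * ‖embed p f‖ := by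
  obtain ⟨C₁, h₁, H₁⟩ := exists_norm_embed_lineDeriv_le (d := d) (p - 1)
  obtain ⟨C₂, h₂, H₂⟩ := exists_norm_embed_lineDeriv_le (d := d) (p - 1 / 2)
  refine ⟨d * (C₁ * C₂), by positivity, fun f => ?_⟩
  rw [laplacian_eq_sum_basisVec, map_sum]
  refine (norm_sum_le _ _).trans ?_
  have : ∀ j ∈ (Finset.univ : Finset (Fin d)),
      ‖embed (p - 1) (∂_{basisVec j} (∂_{basisVec j} f : 𝓢(Euc d, ℝ)))‖ ≤ C₁ * C₂ * ‖embed p f‖ := by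
    intro j _
    have a := H₁ j (∂_{basisVec j} f)
    have b := H₂ j f
    rw [show p - 1 + 1 / 2 = p - 1 / 2 by ring] at a
    rw [show p - 1 / 2 + 1 / 2 = p by ring] at b
    rw [mul_assoc]
    exact a.trans (by gcongr)
  refine (Finset.sum_le_sum this).trans (le_of_eq ?_)
  rw [Finset.sum_const, Finset.card_univ, Fintype.card_fin, nsmul_eq_mul]
  ring

theorem norm_embed_mono (h : q ≤ p) (f : 𝓢(Euc d, ℝ)) : ‖embed q f‖ ≤ ‖embed p f‖ := by
  refine (sq_le_sq₀ (norm_nonneg _) (norm_nonneg _)).1 ?_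
  refine hasSum_le (fun k => ?_) (hasSum_norm_sq q f) (hasSum_norm_sq p f)
  gcongr
  exact one_le_hermiteEig k

/-- The inclusion `𝓢_p ⊆ 𝓢_q` for `q ≤ p`. -/
theorem exists_inclusion (h : q ≤ p) :
    ∃ J : Sp d p →L[ℝ] Sp d q, (∀ f, J (embed p f) = embed q f) ∧ ∀ u, (J u).toTD = u.toTD := by
  obtain ⟨J, -, h1, h2⟩ := exists_extension (p := p) (q := q) (ContinuousLinearMap.id ℝ 𝓢(Euc d, ℝ))
    (ContinuousLinearMap.id ℝ _) (fun f g => rfl) zero_le_one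
    (fun f => by rw [one_mul]; exact norm_embed_mono h f)
  exact ⟨J, h1, fun u => by rw [h2]; exact ContinuousLinearMap.comp_id _⟩

/-- The distributional Laplacian is bounded from `𝓢_p` to `𝓢_{p-1}`. -/
theorem exists_laplacian (d : ℕ) [NeZero d] (p : ℝ) :
    ∃ Λ : Sp d p →L[ℝ] Sp d (p - 1),
      (∀ f, Λ (embed p f) = embed (p - 1) (Δ f)) ∧ ∀ u, (Λ u).toTD = laplacian u.toTD := by
  obtain ⟨C, hC, H⟩ := exists_norm_embed_laplacian_le d p
  obtain ⟨Λ, -, h1, h2⟩ := exists_extension (p := p) (q := p - 1)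
    (laplacianCLM ℝ (Euc d) 𝓢(Euc d, ℝ)) (laplacianCLM ℝ (Euc d) 𝓢(Euc d, ℝ))
    (fun f g => (SchwartzMap.integral_mul_laplacian_right_eq_left f g (μ := volume)).symm) hC H
  exact ⟨Λ, h1, h2⟩

end

section

open LineDeriv Laplacian

variable {d : ℕ}

/-! ### Translations of Schwartz functions -/

/-- The translate `y ↦ f (y - x)` of a Schwartz function. -/
abbrev tr (x : Euc d) : 𝓢(Euc d, ℝ) →L[ℝ] 𝓢(Euc d, ℝ) := SchwartzMap.compSubConstCLM ℝ x

theorem tr_apply (x y : Euc d) (f : 𝓢(Euc d, ℝ)) : tr x f y = f (y - x) := rfl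

theorem tr_zero (f : 𝓢(Euc d, ℝ)) : tr 0 f = f := by
  ext y; rw [tr_apply, sub_zero]

theorem lineDeriv_tr (v x : Euc d) (f : 𝓢(Euc d, ℝ)) : ∂_{v} (tr x f) = tr x (∂_{v} f) := by
  ext y
  rw [tr_apply, SchwartzMap.lineDerivOp_apply, SchwartzMap.lineDerivOp_apply, lineDeriv, lineDeriv]
  simp only [tr_apply, sub_add_eq_add_sub]

theorem integral_tr_mul (x : Euc d) (f g : 𝓢(Euc d, ℝ)) :
    ∫ y, tr x f y * g y = ∫ y, f y * tr (-x) g y := by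
  rw [← integral_sub_right_eq_self (fun y => f y * tr (-x) g y) x]
  simp only [tr_apply, sub_neg_eq_add, sub_add_cancel]

theorem lineDeriv_eq_sum (v : Euc d) (f : 𝓢(Euc d, ℝ)) : ∂_{v} f = ∑ j, v j • ∂_{basisVec j} f := by
  have hv : v = ∑ j, v j • basisVec j := by
    ext i
    simp [basisVec, Finset.sum_apply, Pi.single_apply]
  conv_lhs => rw [hv]
  rw [lineDerivOp_left_sum]
  simp only [lineDerivOp_left_smul]

theorem exists_seminorm_tr_le (i : ℕ × ℕ) (f : 𝓢(Euc d, ℝ)) :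
    ∃ C : ℝ, 0 ≤ C ∧ ∀ x, schwartzSeminormFamily ℝ (Euc d) ℝ i (tr x f) ≤ C * (1 + ‖x‖) ^ i.1 := by
  set C := 2 ^ i.1 * ((Finset.Iic i).sup fun m => SchwartzMap.seminorm ℝ m.1 m.2) f with hC
  have hC0 : 0 ≤ C := by positivity
  refine ⟨C, hC0, fun x => SchwartzMap.seminorm_le_bound ℝ i.1 i.2 _ (by positivity) fun y => ?_⟩
  have h1 := SchwartzMap.one_add_le_sup_seminorm_apply (𝕜 := ℝ) (m := i) le_rfl le_rfl f (y - x)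
  have h2 : iteratedFDeriv ℝ i.2 (tr x f) y = iteratedFDeriv ℝ i.2 f (y - x) :=
    iteratedFDeriv_comp_sub (f := f) i.2 x y
  rw [h2]
  have h3 : ‖y‖ ≤ (1 + ‖x‖) * (1 + ‖y - x‖) := by
    have : ‖y‖ ≤ ‖y - x‖ + ‖x‖ := by simpa using norm_add_le (y - x) x
    nlinarith [norm_nonneg x, norm_nonneg (y - x), mul_nonneg (norm_nonneg x) (norm_nonneg (y - x))]
  calc ‖y‖ ^ i.1 * ‖iteratedFDeriv ℝ i.2 f (y - x)‖
      ≤ ((1 + ‖x‖) * (1 + ‖y - x‖)) ^ i.1 * ‖iteratedFDeriv ℝ i.2 f (y - x)‖ := by gcongr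
    _ = (1 + ‖x‖) ^ i.1 * ((1 + ‖y - x‖) ^ i.1 * ‖iteratedFDeriv ℝ i.2 f (y - x)‖) := by
        rw [mul_pow]; ring
    _ ≤ (1 + ‖x‖) ^ i.1 * C := by gcongr
    _ = _ := mul_comm _ _

/-- Continuous linear images of the translates of a Schwartz function grow polynomially. -/
theorem exists_norm_clm_tr_le {E : Type*} [NormedAddCommGroup E] [NormedSpace ℝ E]
    (A : 𝓢(Euc d, ℝ) →L[ℝ] E) (f : 𝓢(Euc d, ℝ)) :
    ∃ (C : ℝ) (m : ℕ), 0 ≤ C ∧ ∀ x, ‖A (tr x f)‖ ≤ C * (1 + ‖x‖) ^ m := by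
  obtain ⟨s, c, -, hq⟩ := Seminorm.bound_of_continuous (schwartz_withSeminorms ℝ (Euc d) ℝ)
    ((normSeminorm ℝ E).comp (A : 𝓢(Euc d, ℝ) →ₗ[ℝ] E)) (continuous_norm.comp A.continuous)
  have hs : ∃ (C : ℝ) (m : ℕ), 0 ≤ C ∧ ∀ x,
      ∑ i ∈ s, schwartzSeminormFamily ℝ (Euc d) ℝ i (tr x f) ≤ C * (1 + ‖x‖) ^ m := by
    clear hq
    induction s using Finset.induction_on with
    | empty => exact ⟨0, 0, le_rfl, fun x => by simp⟩
    | insert i s his ih =>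
      obtain ⟨C₁, m, hC₁, h₁⟩ := ih
      obtain ⟨C₂, hC₂, h₂⟩ := exists_seminorm_tr_le i f
      refine ⟨C₂ + C₁, m + i.1, by positivity, fun x => ?_⟩
      rw [Finset.sum_insert his, add_mul]
      have hx : (1 : ℝ) ≤ 1 + ‖x‖ := by linarith [norm_nonneg x]
      refine add_le_add ((h₂ x).trans ?_) ((h₁ x).trans ?_)
      · gcongr
        omega
      · gcongr
        omega
  obtain ⟨C, m, hC, h⟩ := hs
  refine ⟨c * C, m, by positivity, fun x => ?_⟩
  have h1 : ‖A (tr x f)‖ ≤ c * (s.sup (schwartzSeminormFamily ℝ (Euc d) ℝ)) (tr x f) := hq (tr x f)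
  refine h1.trans ?_
  rw [mul_assoc]
  gcongr
  exact (Seminorm.finset_sup_apply_le (Finset.sum_nonneg fun i _ => apply_nonneg _ _) fun i hi =>
    Finset.single_le_sum (f := fun i => schwartzSeminormFamily ℝ (Euc d) ℝ i (tr x f))
      (fun i _ => apply_nonneg _ _) hi).trans (h x)

theorem hasDerivAt_tr_apply (x v y : Euc d) (f : 𝓢(Euc d, ℝ)) (t : ℝ) :
    HasDerivAt (fun t : ℝ => tr (x + t • v) f y) (-(tr (x + t • v) (∂_{v} f) y)) t := by
  simp only [tr_apply]
  have h1 : HasDerivAt (fun t : ℝ => y - (x + t • v)) (-v) t := by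
    have := (((hasDerivAt_id t).smul_const v).const_add x).const_sub y
    simpa using this
  have h2 := (f.hasFDerivAt (y - (x + t • v))).comp_hasDerivAt t h1
  rw [map_neg] at h2
  rwa [SchwartzMap.lineDerivOp_apply_eq_fderiv]

theorem hasDerivAt_coef_tr (x v : Euc d) (f : 𝓢(Euc d, ℝ)) (k : Fin d → ℕ) (t : ℝ) :
    HasDerivAt (fun t : ℝ => coef (tr (x + t • v) f) k) (-coef (tr (x + t • v) (∂_{v} f)) k) t := by
  have h := (hasDerivAt_integral_of_dominated_loc_of_deriv_le (μ := (volume : Measure (Euc d)))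
    (s := Set.univ) (x₀ := t)
    (F := fun t y => hermiteS k y * tr (x + t • v) f y)
    (F' := fun t y => hermiteS k y * -(tr (x + t • v) (∂_{v} f) y))
    (bound := fun y => ‖hermiteS k y‖ * SchwartzMap.seminorm ℝ 0 0 (∂_{v} f)) univ_mem
    (Eventually.of_forall fun t => (integrable_schwartz_mul _ _).1) (integrable_schwartz_mul _ _)
    (by simp only [mul_neg]; exact (integrable_schwartz_mul _ _).1.neg)
    (Eventually.of_forall fun y t _ => by
      rw [norm_mul, norm_neg]
      gcongr
      rw [tr_apply]
      exact SchwartzMap.norm_le_seminorm ℝ (∂_{v} f) _)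
    ((hermiteS k).integrable.norm.mul_const _)
    (Eventually.of_forall fun y t _ => (hasDerivAt_tr_apply x v y f t).const_mul _)).2
  simp only [mul_neg, integral_neg] at h
  exact h

theorem continuous_coef_tr (f : 𝓢(Euc d, ℝ)) (k : Fin d → ℕ) :
    Continuous fun x => coef (tr x f) k := by
  refine continuous_of_dominated (bound := fun y => ‖hermiteS k y‖ * SchwartzMap.seminorm ℝ 0 0 f)
    (fun x => (integrable_schwartz_mul _ _).1) (fun x => Eventually.of_forall fun y => ?_)
    ((hermiteS k).integrable.norm.mul_const _) (Eventually.of_forall fun y => ?_)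
  · rw [norm_mul]
    gcongr
    exact SchwartzMap.norm_le_seminorm ℝ f _
  · exact continuous_const.mul (f.continuous.comp (continuous_const.sub continuous_id))

/-! ### Summability of negative powers of the eigenvalues -/

theorem summable_prod_inv_sq (d : ℕ) :
    Summable fun k : Fin d → ℕ => ∏ j, (1 / ((k j : ℝ) + 1) ^ 2) := by
  have h1 : Summable fun n : ℕ => 1 / ((n : ℝ) + 1) ^ 2 := by
    have := (summable_nat_add_iff 1).2 (Real.summable_one_div_nat_pow.2 one_lt_two)
    exact_mod_cast this
  refine summable_of_sum_le (c := (∑' n : ℕ, 1 / ((n : ℝ) + 1) ^ 2) ^ d)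
    (fun k => Finset.prod_nonneg fun j _ => by positivity) fun s => ?_
  have hs : s ⊆ Fintype.piFinset fun _ : Fin d => Finset.range (s.sup (fun k => ∑ j, k j) + 1) := by
    intro k hk
    rw [Fintype.mem_piFinset]
    intro j
    rw [Finset.mem_range, Nat.lt_succ_iff]
    exact (Finset.single_le_sum (fun _ _ => Nat.zero_le _) (Finset.mem_univ j)).trans
      (Finset.le_sup (f := fun k : Fin d → ℕ => ∑ j, k j) hk)
  refine (Finset.sum_le_sum_of_subset_of_nonneg hs fun k _ _ =>
    Finset.prod_nonneg fun j _ => by positivity).trans ?_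
  rw [← Finset.prod_univ_sum (fun _ : Fin d => Finset.range (s.sup (fun k => ∑ j, k j) + 1))
    (fun _ n => 1 / ((n : ℝ) + 1) ^ 2), Finset.prod_const, Finset.card_univ, Fintype.card_fin]
  gcongr
  exact h1.sum_le_tsum _ fun n _ => by positivity

variable [NeZero d] {p q : ℝ}

/-- The exponent is convenient rather than optimal: `w_k^{-2d}` is bounded by the product of the
`(k_j + 1)^{-2}`. -/
theorem summable_hermiteEig_rpow (d : ℕ) [NeZero d] :
    Summable fun k : Fin d → ℕ => hermiteEig k ^ (-(2 * d : ℝ)) := by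
  refine Summable.of_nonneg_of_le (fun k => Real.rpow_nonneg (hermiteEig_nonneg k) _) (fun k => ?_)
    (summable_prod_inv_sq d)
  have hw := one_le_hermiteEig k
  have hw0 := hermiteEig_pos k
  have e : hermiteEig k ^ (-(2 * d : ℝ)) = ∏ _j : Fin d, (1 / hermiteEig k ^ 2) := by
    rw [Finset.prod_const, Finset.card_univ, Fintype.card_fin, Real.rpow_neg hw0.le, one_div, inv_pow,
      ← pow_mul]
    norm_cast
  rw [e]
  refine Finset.prod_le_prod (fun j _ => by positivity) fun j _ => ?_
  have h1 : k j ≤ ∑ i, k i := Finset.single_le_sum (fun _ _ => Nat.zero_le _) (Finset.mem_univ j)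
  have h2 : (k j : ℝ) ≤ (∑ i, k i : ℕ) := by exact_mod_cast h1
  have h3 : (1 : ℝ) ≤ d := by exact_mod_cast Nat.pos_of_ne_zero (NeZero.ne d)
  have h4 : (0 : ℝ) ≤ k j := by positivity
  gcongr
  unfold hermiteEig
  linarith

/-! ### Differentiability of the translates in `𝓢_p` -/

theorem hasSum_coef_smul_embed (p : ℝ) (f : 𝓢(Euc d, ℝ)) :
    HasSum (fun k => coef f k • embed p (hermiteS k)) (embed p f) :=
  (embed p f).hasSum_hermite.congr_fun fun k => by rw [toTD_embed_hermiteS]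

theorem norm_embed_hermiteS (p : ℝ) (k : Fin d → ℕ) : ‖embed p (hermiteS k)‖ = hermiteEig k ^ p := by
  rw [← sq_eq_sq₀ (norm_nonneg _) (Real.rpow_nonneg (hermiteEig_nonneg k) p)]
  refine (hasSum_norm_sq p (hermiteS k)).unique ?_
  convert! hasSum_ite_eq k ((hermiteEig k ^ p) ^ 2) using 1
  funext m
  rw [coef_hermiteS]
  split_ifs with h
  · rw [h, two_mul, Real.rpow_add (hermiteEig_pos k)]; ring
  · ring

theorem abs_coef_le (q : ℝ) (f : 𝓢(Euc d, ℝ)) (k : Fin d → ℕ) :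
    |coef f k| ≤ hermiteEig k ^ (-q) * ‖embed q f‖ := by
  have h := lp.norm_apply_le_norm (p := 2) (by simp) (embed q f).toLp k
  rw [toLp_embed, norm_mul, Real.norm_of_nonneg (Real.rpow_nonneg (hermiteEig_nonneg k) q),
    ← Sp.norm_eq, Real.norm_eq_abs] at h
  have hw : 0 < hermiteEig k ^ q := Real.rpow_pos_of_pos (hermiteEig_pos k) q
  rw [Real.rpow_neg (hermiteEig_nonneg k), inv_mul_eq_div, le_div_iff₀ hw, mul_comm]
  exact h

/-- The Hermite series of the translates of a Schwartz function is dominated in `𝓢_p` by a fixed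
summable series, locally uniformly in the translation. -/
theorem exists_summable_bound (p : ℝ) (f : 𝓢(Euc d, ℝ)) (R : ℝ) :
    ∃ u : (Fin d → ℕ) → ℝ, Summable u ∧ ∀ k x, ‖x‖ ≤ R →
      ‖coef (tr x f) k • embed p (hermiteS k)‖ ≤ u k := by
  -- The extra `2 d` orders of smoothness pay for the summation over `k`.
  obtain ⟨C, m, hC, h⟩ := exists_norm_clm_tr_le (embed (p + 2 * d)) f
  refine ⟨_, (summable_hermiteEig_rpow d).mul_right (C * (1 + R) ^ m), fun k x hx => ?_⟩
  rw [norm_smul, norm_embed_hermiteS, Real.norm_eq_abs]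
  have hw0 := hermiteEig_pos k
  have h1 : ‖embed (p + 2 * d) (tr x f)‖ ≤ C * (1 + R) ^ m := (h x).trans (by gcongr)
  calc |coef (tr x f) k| * hermiteEig k ^ p
      ≤ hermiteEig k ^ (-(p + 2 * d)) * ‖embed (p + 2 * d) (tr x f)‖ * hermiteEig k ^ p := by
        gcongr
        exact abs_coef_le _ _ _
    _ = hermiteEig k ^ (-(2 * d : ℝ)) * ‖embed (p + 2 * d) (tr x f)‖ := by
        rw [mul_right_comm, ← Real.rpow_add hw0]
        congr 2
        ring
    _ ≤ _ := by gcongr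

theorem continuous_embed_tr (p : ℝ) (f : 𝓢(Euc d, ℝ)) : Continuous fun x => embed p (tr x f) := by
  rw [continuous_iff_continuousAt]
  intro x
  obtain ⟨u, hu, h⟩ := exists_summable_bound p f (‖x‖ + 1)
  have e : (fun x => embed p (tr x f)) = fun x => ∑' k, coef (tr x f) k • embed p (hermiteS k) :=
    funext fun x => (hasSum_coef_smul_embed p (tr x f)).tsum_eq.symm
  rw [e]
  refine (continuousOn_tsum (s := Metric.ball x 1)
    (fun k => ((continuous_coef_tr f k).smul continuous_const).continuousOn) hu
    fun k y hy => h k y ?_).continuousAt (Metric.ball_mem_nhds x one_pos)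
  have := norm_add_le x (y - x)
  rw [add_sub_cancel] at this
  rw [mem_ball_iff_norm] at hy
  linarith

/-- Translates of a Schwartz function are differentiable in the norm of `𝓢_p`, by termwise
differentiation of the Hermite series. -/
theorem hasDerivAt_embed_tr (p : ℝ) (x v : Euc d) (f : 𝓢(Euc d, ℝ)) (t : ℝ) :
    HasDerivAt (fun t : ℝ => embed p (tr (x + t • v) f))
      (-embed p (tr (x + t • v) (∂_{v} f))) t := by
  obtain ⟨u, hu, h⟩ := exists_summable_bound p (∂_{v} f) (‖x‖ + (|t| + 1) * ‖v‖)
  have e : (fun t : ℝ => embed p (tr (x + t • v) f)) =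
      fun t => ∑' k, coef (tr (x + t • v) f) k • embed p (hermiteS k) :=
    funext fun t => (hasSum_coef_smul_embed p (tr (x + t • v) f)).tsum_eq.symm
  have h' := hasDerivAt_tsum_of_isPreconnected (t := Metric.ball t 1) (y₀ := t) (y := t) hu
    Metric.isOpen_ball (convex_ball t 1).isPreconnected
    (g := fun k t => coef (tr (x + t • v) f) k • embed p (hermiteS k))
    (g' := fun k t => (-coef (tr (x + t • v) (∂_{v} f)) k) • embed p (hermiteS k))
    (fun k s _ => (hasDerivAt_coef_tr x v f k s).smul_const _)
    (fun k s hs => by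
      rw [neg_smul, norm_neg]
      refine h k _ ?_
      refine (norm_add_le _ _).trans ?_
      rw [norm_smul, Real.norm_eq_abs]
      gcongr
      have := abs_add_le t (s - t)
      rw [add_sub_cancel] at this
      rw [Metric.mem_ball, Real.dist_eq] at hs
      linarith)
    (Metric.mem_ball_self one_pos) (hasSum_coef_smul_embed p _).summable
    (Metric.mem_ball_self one_pos)
  rw [e]
  convert! h' using 1
  simp only [neg_smul]
  rw [tsum_neg, (hasSum_coef_smul_embed p _).tsum_eq]

/-! ### The translation operators on `𝓢_p` -/

/-- Grönwall's inequality. -/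
theorem le_mul_exp_of_deriv_le {N N' : ℝ → ℝ} {K T : ℝ} (hT : 0 ≤ T)
    (hN : ∀ t, HasDerivAt N (N' t) t) (h : ∀ t ∈ Set.Ioo 0 T, N' t ≤ K * N t) :
    N T ≤ N 0 * Real.exp (K * T) := by
  have hd : ∀ t, HasDerivAt (fun t => N t * Real.exp (-(K * t)))
      (N' t * Real.exp (-(K * t)) + N t * (Real.exp (-(K * t)) * -K)) t := by
    intro t
    have h1 : HasDerivAt (fun t : ℝ => Real.exp (-(K * t))) (Real.exp (-(K * t)) * -K) t := by
      have := (((hasDerivAt_id t).const_mul K).neg).exp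
      simpa using this
    exact (hN t).mul h1
  have ha : AntitoneOn (fun t => N t * Real.exp (-(K * t))) (Set.Icc 0 T) := by
    refine antitoneOn_of_deriv_nonpos (convex_Icc 0 T)
      (fun t _ => (hd t).continuousAt.continuousWithinAt)
      (fun t _ => (hd t).differentiableAt.differentiableWithinAt) fun t ht => ?_
    rw [interior_Icc] at ht
    rw [(hd t).deriv]
    have := h t ht
    nlinarith [Real.exp_pos (-(K * t))]
  have h2 := ha (Set.left_mem_Icc.2 hT) (Set.right_mem_Icc.2 hT) hT
  simp only [mul_zero, neg_zero, Real.exp_zero, mul_one] at h2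
  calc N T = N T * Real.exp (-(K * T)) * Real.exp (K * T) := by
        rw [mul_assoc, ← Real.exp_add]; simp
    _ ≤ _ := by gcongr

/-- The energy estimate: on the diagonal the skew-adjoint part of the derivative drops out, and no
derivative is lost. -/
theorem exists_abs_ip_lineDeriv_self_le (d : ℕ) [NeZero d] (p : ℝ) :
    ∃ K : ℝ, 0 ≤ K ∧ ∀ (v : Euc d) (f : 𝓢(Euc d, ℝ)),
      |ip p f (∂_{v} f)| ≤ K * ‖v‖ * ‖embed p f‖ ^ 2 := by
  set C : ℝ := 2 * (8 * |p| * Real.exp (4 * |p|) * 3 ^ |p|) with hC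
  have hC0 : 0 ≤ C := by positivity
  refine ⟨d * C, by positivity, fun v f => ?_⟩
  rw [lineDeriv_eq_sum, ip, map_sum, map_sum, inner_sum]
  refine (Finset.abs_sum_le_sum_abs _ _).trans ?_
  have hj : ∀ j ∈ (Finset.univ : Finset (Fin d)),
      |inner ℝ (embed p f).toLp (embed p (v j • ∂_{basisVec j} f)).toLp| ≤
        ‖v‖ * (C * ‖embed p f‖ ^ 2) := by
    intro j _
    have h := abs_ip_lineDeriv_add_le j p f f one_pos
    rw [ip_comm (∂_{basisVec j} f) f, ← two_mul, abs_mul, abs_two, ← hC, inv_one] at h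
    rw [map_smul, map_smul, inner_smul_right, abs_mul]
    refine mul_le_mul (PiLp.norm_apply_le v j) ?_ (abs_nonneg _) (norm_nonneg _)
    change |ip p f (∂_{basisVec j} f)| ≤ _
    linarith
  refine (Finset.sum_le_sum hj).trans (le_of_eq ?_)
  rw [Finset.sum_const, Finset.card_univ, Fintype.card_fin, nsmul_eq_mul]
  ring

/-- The energy estimate integrated along the segment from `0` to `x`. -/
theorem exists_norm_embed_tr_le (d : ℕ) [NeZero d] (p : ℝ) :
    ∃ K : ℝ, 0 ≤ K ∧ ∀ (x : Euc d) (f : 𝓢(Euc d, ℝ)),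
      ‖embed p (tr x f)‖ ≤ Real.exp (K * ‖x‖) * ‖embed p f‖ := by
  obtain ⟨K, hK, H⟩ := exists_abs_ip_lineDeriv_self_le d p
  refine ⟨K, hK, fun v f => ?_⟩
  have hd : ∀ t : ℝ, HasDerivAt (fun t : ℝ => ‖toLpLI d p (embed p (tr (0 + t • v) f))‖ ^ 2)
      (2 * inner ℝ (toLpLI d p (embed p (tr (0 + t • v) f)))
        (toLpLI d p (-embed p (tr (0 + t • v) (∂_{v} f))))) t := fun t =>
    ((toLpLI d p).toContinuousLinearMap.hasFDerivAt.comp_hasDerivAt t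
      (hasDerivAt_embed_tr p 0 v f t)).norm_sq
  have h := le_mul_exp_of_deriv_le (K := 2 * (K * ‖v‖)) zero_le_one hd (fun t _ => by
    rw [map_neg, inner_neg_right, ← lineDeriv_tr, LinearIsometry.norm_map]
    have h1 := H v (tr (0 + t • v) f)
    have h2 := (abs_le.1 h1).1
    simp only [toLpLI_apply]
    change 2 * -ip p (tr (0 + t • v) f) (∂_{v} (tr (0 + t • v) f)) ≤ _
    linarith)
  simp only [LinearIsometry.norm_map, zero_add, one_smul, zero_smul, tr_zero, mul_one] at h
  refine (sq_le_sq₀ (norm_nonneg _) (by positivity)).1 (h.trans (le_of_eq ?_))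
  rw [mul_pow, ← Real.exp_nat_mul, mul_comm]
  push_cast
  rfl

/-- Existence of the translation operators on `𝓢_p`, with exponential bounds and strong
continuity. -/
theorem exists_translation (d : ℕ) [NeZero d] (p : ℝ) :
    ∃ (τ : Euc d → Sp d p →L[ℝ] Sp d p) (K : ℝ), 0 ≤ K ∧
      (∀ x, ‖τ x‖ ≤ Real.exp (K * ‖x‖)) ∧
      (∀ x u, (τ x u).toTD = translate x u.toTD) ∧
      ∀ u, Continuous fun x => τ x u := by
  obtain ⟨K, hK, H⟩ := exists_norm_embed_tr_le d p
  have hex := fun x : Euc d => exists_extension (p := p) (q := p) (tr x) (tr (-x))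
    (integral_tr_mul x) (Real.exp_pos _).le (H x)
  choose τ hτ hτe hτd using hex
  refine ⟨τ, K, hK, hτ, hτd, fun u => ?_⟩
  -- Locally uniform approximation by the translates of Schwartz functions.
  refine continuous_of_locally_uniform_approx_of_continuousAt fun x U hU => ?_
  obtain ⟨ε, hε, hεU⟩ := Metric.mem_uniformity_dist.1 hU
  set M := Real.exp (K * (‖x‖ + 1)) with hM
  have hM0 : 0 < M := Real.exp_pos _
  obtain ⟨f, hf⟩ := (denseRange_embed (p := p)).exists_dist_lt u (ε := ε / M) (by positivity)
  refine ⟨Metric.ball x 1, Metric.ball_mem_nhds x one_pos, fun y => embed p (tr y f),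
    (continuous_embed_tr p f).continuousAt, fun y hy => hεU ?_⟩
  change dist (τ y u) (embed p (tr y f)) < ε
  rw [← hτe, dist_eq_norm, ← map_sub]
  have h1 : ‖y‖ ≤ ‖x‖ + 1 := by
    have := norm_add_le x (y - x)
    rw [add_sub_cancel] at this
    rw [mem_ball_iff_norm] at hy
    linarith
  have h2 : ‖τ y‖ ≤ M := (hτ y).trans (Real.exp_le_exp.2 (by gcongr))
  rw [dist_eq_norm, lt_div_iff₀ hM0] at hf
  calc ‖(τ y) (u - embed p f)‖ ≤ ‖τ y‖ * ‖u - embed p f‖ := (τ y).le_opNorm _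
    _ ≤ M * ‖u - embed p f‖ := by gcongr
    _ < ε := by linarith

end

section

open LineDeriv Laplacian

variable {d : ℕ}

/-! ### The heat kernel -/

theorem heatKernel_nonneg {t : ℝ} (ht : 0 < t) (x : Euc d) : 0 ≤ heatKernel t x := by
  unfold heatKernel; positivity

theorem continuous_heatKernel (t : ℝ) : Continuous (heatKernel t : Euc d → ℝ) := by
  unfold heatKernel; fun_prop

theorem heatKernel_le {t : ℝ} (ht : 0 < t) (x : Euc d) :
    heatKernel t x ≤ 1 / (2 * Real.pi * t) ^ ((d : ℝ) / 2) := by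
  unfold heatKernel
  refine mul_le_of_le_one_right (by positivity) (Real.exp_le_one_iff.2 ?_)
  rw [neg_nonpos]
  positivity

theorem heatKernel_smul {t : ℝ} (ht : 0 < t) (z : Euc d) :
    heatKernel t (Real.sqrt t • z) = (Real.sqrt t ^ d)⁻¹ * heatKernel 1 z := by
  have h1 : ‖Real.sqrt t • z‖ ^ 2 / (2 * t) = ‖z‖ ^ 2 / (2 * 1) := by
    rw [norm_smul, mul_pow, Real.norm_eq_abs, sq_abs, Real.sq_sqrt ht.le]
    field_simp
  have h2 : (2 * Real.pi * t) ^ ((d : ℝ) / 2) = (2 * Real.pi * 1) ^ ((d : ℝ) / 2) * Real.sqrt t ^ d := by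
    rw [mul_one, Real.mul_rpow (by positivity) ht.le, Real.sqrt_eq_rpow, ← Real.rpow_mul_natCast ht.le]
    congr 2
    ring
  unfold heatKernel
  rw [h1, h2]
  field_simp

theorem integral_heatKernel_one : ∫ z : Euc d, heatKernel 1 z = 1 := by
  have h := GaussianFourier.integral_rexp_neg_mul_sq_norm (V := Euc d) (b := 1 / 2) (by norm_num)
  unfold heatKernel
  rw [integral_const_mul]
  have e : ∀ x : Euc d, Real.exp (-(‖x‖ ^ 2 / (2 * 1))) = Real.exp (-(1 / 2) * ‖x‖ ^ 2) := by
    intro x; congr 1; ring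
  simp only [e, h, finrank_euclideanSpace_fin]
  rw [show Real.pi / (1 / 2) = 2 * Real.pi * 1 by ring]
  have := Real.pi_pos
  exact one_div_mul_cancel (by positivity)

theorem integrable_heatKernel_mul_exp (c : ℝ) :
    Integrable fun z : Euc d => heatKernel 1 z * Real.exp (c * ‖z‖) := by
  refine ((gaussian d (1 / 4) (by norm_num)).integrable.const_mul
    (1 / (2 * Real.pi * 1) ^ ((d : ℝ) / 2) * Real.exp (c ^ 2))).mono'
    ((continuous_heatKernel 1).mul (by fun_prop)).aestronglyMeasurable
    (Eventually.of_forall fun z => ?_)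
  rw [Real.norm_of_nonneg (mul_nonneg (heatKernel_nonneg one_pos z) (Real.exp_pos _).le)]
  unfold heatKernel
  change _ ≤ _ * Real.exp (-(1 / 4) * ‖z‖ ^ 2)
  rw [mul_assoc (1 / (2 * Real.pi * 1) ^ ((d : ℝ) / 2)), mul_assoc (1 / (2 * Real.pi * 1) ^ ((d : ℝ) / 2)),
    ← Real.exp_add, ← Real.exp_add]
  refine mul_le_mul_of_nonneg_left (Real.exp_le_exp.2 ?_) (by positivity)
  nlinarith [sq_nonneg (‖z‖ / 2 - c)]

theorem heatKernelS_eq_tr {t : ℝ} (ht : 0 < t) (x : Euc d) :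
    heatKernelS t ht x = tr x (heatKernelS t ht 0) := by
  ext y
  rw [heatKernelS_apply, tr_apply, heatKernelS_apply, zero_sub, neg_sub]

theorem integrable_heatKernel {t : ℝ} (ht : 0 < t) : Integrable (heatKernel t : Euc d → ℝ) := by
  have h := (heatKernelS (d := d) t ht 0).integrable (μ := volume)
  refine h.congr (Eventually.of_forall fun x => ?_)
  rw [heatKernelS_apply, zero_sub]
  unfold heatKernel
  rw [norm_neg]

theorem integrable_one_add_norm_pow_mul (m : ℕ) (f : 𝓢(Euc d, ℝ)) :
    Integrable fun x => (1 + ‖x‖) ^ m * |f x| := by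
  have h1 : (fun x : Euc d => (1 + ‖x‖ ^ 2) ^ m).HasTemperateGrowth := by fun_prop
  refine ((SchwartzMap.smulLeftCLM ℝ (fun x : Euc d => (1 + ‖x‖ ^ 2) ^ m)
    f).integrable.norm.const_mul (2 ^ m)).mono' ?_ (Eventually.of_forall fun x => ?_)
  · exact (Continuous.mul (by fun_prop) f.continuous.abs).aestronglyMeasurable
  · rw [SchwartzMap.smulLeftCLM_apply_apply h1, norm_mul, smul_eq_mul, norm_mul,
      Real.norm_eq_abs (|f x|), abs_abs, Real.norm_eq_abs (f x), Real.norm_of_nonneg (by positivity),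
      Real.norm_of_nonneg (by positivity), ← mul_assoc, ← mul_pow]
    gcongr
    nlinarith [sq_nonneg (‖x‖ - 1), norm_nonneg x]

/-- Fubini's theorem for the heat kernel tested on two Schwartz functions. -/
theorem integral_heatKernel_swap {t : ℝ} (ht : 0 < t) (g f : 𝓢(Euc d, ℝ)) :
    ∫ y, heatKernel t y * ∫ z, g z * f (z + y) =
      ∫ x, (∫ z, g z * heatKernel t (x - z)) * f x := by
  have h1 : Integrable (Function.uncurry fun y z : Euc d => heatKernel t y * (g z * f (z + y)))
      (volume.prod volume) := by
    have h := ((integrable_heatKernel (d := d) ht).mul_prod (g.integrable (μ := volume))).bdd_mul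
      (f := fun w : Euc d × Euc d => f (w.2 + w.1)) (c := SchwartzMap.seminorm ℝ 0 0 f)
      (f.continuous.comp (by fun_prop)).aestronglyMeasurable
      (Eventually.of_forall fun w => SchwartzMap.norm_le_seminorm ℝ f _)
    refine h.congr (Eventually.of_forall fun w => ?_)
    simp only [Function.uncurry]
    ring
  have h2 : Integrable (Function.uncurry fun z x : Euc d => g z * heatKernel t (x - z) * f x)
      (volume.prod volume) := by
    have h := ((g.integrable (μ := volume)).mul_prod (f.integrable (μ := volume))).bdd_mul
      (f := fun w : Euc d × Euc d => heatKernel t (w.2 - w.1))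
      (c := 1 / (2 * Real.pi * t) ^ ((d : ℝ) / 2))
      ((continuous_heatKernel t).comp (by fun_prop)).aestronglyMeasurable
      (Eventually.of_forall fun w => by
        rw [Real.norm_of_nonneg (heatKernel_nonneg ht _)]; exact heatKernel_le ht _)
    refine h.congr (Eventually.of_forall fun w => ?_)
    simp only [Function.uncurry]
    ring
  have e1 : ∀ z : Euc d, ∫ y, heatKernel t y * (g z * f (z + y)) =
      ∫ x, g z * heatKernel t (x - z) * f x := by
    intro z
    rw [← integral_sub_right_eq_self _ z]
    congr 1; ext x
    rw [add_sub_cancel]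
    ring
  simp only [← integral_const_mul, ← integral_mul_const]
  rw [integral_integral_swap h1, ← integral_integral_swap h2]
  simp only [e1]

/-- The exponential moments of the standard Gaussian. -/
def gaussMoment (d : ℕ) (c : ℝ) : ℝ := ∫ z : Euc d, heatKernel 1 z * Real.exp (c * ‖z‖)

theorem gaussMoment_nonneg (c : ℝ) : 0 ≤ gaussMoment d c :=
  integral_nonneg fun z => mul_nonneg (heatKernel_nonneg one_pos z) (Real.exp_pos _).le

theorem gaussMoment_mono {c c' : ℝ} (h : c ≤ c') : gaussMoment d c ≤ gaussMoment d c' := by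
  refine integral_mono (integrable_heatKernel_mul_exp c) (integrable_heatKernel_mul_exp c') fun z => ?_
  have := heatKernel_nonneg one_pos z
  dsimp only
  gcongr

variable [NeZero d] {p : ℝ}

/-! ### The heat semigroup on `𝓢_p` -/

/-- The translation operator `τ_x` on `𝓢_p`. -/
def shift (d : ℕ) [NeZero d] (p : ℝ) : Euc d → Sp d p →L[ℝ] Sp d p := (exists_translation d p).choose

/-- An exponential growth rate of the translation operators on `𝓢_p`. -/
def shiftRate (d : ℕ) [NeZero d] (p : ℝ) : ℝ := (exists_translation d p).choose_spec.choose

theorem shiftRate_nonneg : 0 ≤ shiftRate d p := (exists_translation d p).choose_spec.choose_spec.1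

theorem norm_shift_le (x : Euc d) : ‖shift d p x‖ ≤ Real.exp (shiftRate d p * ‖x‖) :=
  (exists_translation d p).choose_spec.choose_spec.2.1 x

theorem toTD_shift (x : Euc d) (u : Sp d p) : (shift d p x u).toTD = translate x u.toTD :=
  (exists_translation d p).choose_spec.choose_spec.2.2.1 x u

theorem continuous_shift (u : Sp d p) : Continuous fun x => shift d p x u :=
  (exists_translation d p).choose_spec.choose_spec.2.2.2 u

theorem toTD_shift_apply (x : Euc d) (u : Sp d p) (f : 𝓢(Euc d, ℝ)) :
    (shift d p x u).toTD f = u.toTD (tr (-x) f) := by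
  rw [toTD_shift]; rfl

theorem shift_zero (u : Sp d p) : shift d p 0 u = u := by
  apply Sp.toTD_injective
  ext f
  rw [toTD_shift_apply, neg_zero, tr_zero]

theorem norm_shift_apply_le (x : Euc d) (u : Sp d p) :
    ‖shift d p x u‖ ≤ Real.exp (shiftRate d p * ‖x‖) * ‖u‖ :=
  ((shift d p x).le_opNorm u).trans (by gcongr; exact norm_shift_le x)

theorem norm_heatKernel_smul_shift_le (a : ℝ) (z : Euc d) (u : Sp d p) :
    ‖heatKernel 1 z • shift d p (a • z) u‖ ≤
      heatKernel 1 z * Real.exp (shiftRate d p * |a| * ‖z‖) * ‖u‖ := by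
  rw [norm_smul, Real.norm_of_nonneg (heatKernel_nonneg one_pos z), mul_assoc]
  have := heatKernel_nonneg one_pos z
  gcongr
  refine (norm_shift_apply_le _ u).trans (le_of_eq ?_)
  rw [norm_smul, Real.norm_eq_abs, mul_assoc]

theorem continuous_heatKernel_smul_shift (a : ℝ) (u : Sp d p) :
    Continuous fun z : Euc d => heatKernel 1 z • shift d p (a • z) u :=
  (continuous_heatKernel 1).smul ((continuous_shift u).comp (continuous_const_smul a))

theorem integrable_heatKernel_smul_shift (a : ℝ) (u : Sp d p) :
    Integrable fun z : Euc d => heatKernel 1 z • shift d p (a • z) u :=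
  ((integrable_heatKernel_mul_exp _).mul_const _).mono'
    (continuous_heatKernel_smul_shift a u).aestronglyMeasurable
    (Eventually.of_forall fun z => norm_heatKernel_smul_shift_le a z u)

/-- The Gaussian average `φ ↦ ∫ p_1(z) τ_{a z} φ dz`, which for `a = √t` is the heat operator at
time `t`. Using the standard deviation `a` as a parameter makes the family smooth at `a = 0`. -/
def gaussAvg (d : ℕ) [NeZero d] (p a : ℝ) : Sp d p →L[ℝ] Sp d p :=
  LinearMap.mkContinuous
    { toFun := fun u => ∫ z : Euc d, heatKernel 1 z • shift d p (a • z) u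
      map_add' := fun u v => by
        simp only [map_add, smul_add]
        exact integral_add (integrable_heatKernel_smul_shift a u) (integrable_heatKernel_smul_shift a v)
      map_smul' := fun c u => by
        simp only [map_smul, smul_comm _ c, RingHom.id_apply]
        exact integral_smul c _ }
    (gaussMoment d (shiftRate d p * |a|)) fun u => by
      refine (norm_integral_le_of_norm_le ((integrable_heatKernel_mul_exp _).mul_const _)
        (Eventually.of_forall fun z => norm_heatKernel_smul_shift_le a z u)).trans (le_of_eq ?_)
      rw [integral_mul_const, gaussMoment]

theorem gaussAvg_apply (a : ℝ) (u : Sp d p) :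
    gaussAvg d p a u = ∫ z : Euc d, heatKernel 1 z • shift d p (a • z) u := rfl

theorem norm_gaussAvg_le (a : ℝ) : ‖gaussAvg d p a‖ ≤ gaussMoment d (shiftRate d p * |a|) :=
  LinearMap.mkContinuous_norm_le _ (gaussMoment_nonneg _) _

theorem gaussAvg_zero (u : Sp d p) : gaussAvg d p 0 u = u := by
  simp only [gaussAvg_apply, zero_smul, shift_zero]
  rw [integral_smul_const, integral_heatKernel_one, one_smul]

theorem continuous_gaussAvg (u : Sp d p) : Continuous fun a : ℝ => gaussAvg d p a u := by
  rw [continuous_iff_continuousAt]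
  intro a
  simp only [gaussAvg_apply]
  refine continuousAt_of_dominated
    (bound := fun z => heatKernel 1 z * Real.exp (shiftRate d p * (|a| + 1) * ‖z‖) * ‖u‖)
    (Eventually.of_forall fun b => (continuous_heatKernel_smul_shift b u).aestronglyMeasurable) ?_
    ((integrable_heatKernel_mul_exp _).mul_const _)
    (Eventually.of_forall fun z => ?_)
  · filter_upwards [Metric.ball_mem_nhds a one_pos] with b hb
    refine Eventually.of_forall fun z => (norm_heatKernel_smul_shift_le b z u).trans ?_
    have h1 : |b| ≤ |a| + 1 := by
      have := abs_add_le a (b - a)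
      rw [add_sub_cancel] at this
      rw [Metric.mem_ball, Real.dist_eq] at hb
      linarith
    have := heatKernel_nonneg one_pos z
    have := shiftRate_nonneg (d := d) (p := p)
    gcongr
  · have hc : Continuous fun b : ℝ => shift d p (b • z) u :=
      (continuous_shift u).comp (continuous_id.smul continuous_const)
    exact (hc.const_smul (heatKernel 1 z)).continuousAt

theorem toTD_gaussAvg (a : ℝ) (u : Sp d p) (f : 𝓢(Euc d, ℝ)) :
    (gaussAvg d p a u).toTD f = ∫ z : Euc d, heatKernel 1 z * (shift d p (a • z) u).toTD f := by
  have h := (evalCLM p f).integral_comp_comm (integrable_heatKernel_smul_shift a u)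
  rw [← gaussAvg_apply, evalCLM_apply] at h
  rw [← h]
  simp

theorem integrable_heatKernel_smul_shift' {t : ℝ} (ht : 0 < t) (u : Sp d p) :
    Integrable fun y : Euc d => heatKernel t y • shift d p y u := by
  have h0 : Real.sqrt t ≠ 0 := (Real.sqrt_pos.2 ht).ne'
  rw [← integrable_comp_smul_iff volume _ h0]
  simp only [heatKernel_smul ht, mul_smul]
  exact (integrable_heatKernel_smul_shift _ u).smul (Real.sqrt t ^ d)⁻¹

/-- The substitution `y = √t z`. -/
theorem gaussAvg_sqrt {t : ℝ} (ht : 0 < t) (u : Sp d p) :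
    gaussAvg d p (Real.sqrt t) u = ∫ y : Euc d, heatKernel t y • shift d p y u := by
  have h0 : 0 < Real.sqrt t := Real.sqrt_pos.2 ht
  have h := Measure.integral_comp_smul (volume : Measure (Euc d))
    (fun y => heatKernel t y • shift d p y u) (Real.sqrt t)
  simp only [heatKernel_smul ht, mul_smul, finrank_euclideanSpace_fin] at h
  rw [integral_smul, abs_of_pos (by positivity), ← gaussAvg_apply] at h
  exact smul_right_injective _ (by positivity : (Real.sqrt t ^ d)⁻¹ ≠ 0) h

theorem toTD_gaussAvg_sqrt {t : ℝ} (ht : 0 < t) (u : Sp d p) (f : 𝓢(Euc d, ℝ)) :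
    (gaussAvg d p (Real.sqrt t) u).toTD f = ∫ y : Euc d, heatKernel t y * (shift d p y u).toTD f := by
  have h := (evalCLM p f).integral_comp_comm (integrable_heatKernel_smul_shift' ht u)
  rw [← gaussAvg_sqrt ht, evalCLM_apply] at h
  rw [← h]
  simp

/-! ### The heat operators as convolutions -/

theorem continuous_convHeat {t : ℝ} (ht : 0 < t) (u : Sp d p) : Continuous (convHeat u.toTD t ht) := by
  have h : convHeat u.toTD t ht =
      fun x => inner ℝ u.toLp (toLpLI d (-p) (embed (-p) (tr x (heatKernelS t ht 0)))) := by
    funext x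
    rw [convHeat, heatKernelS_eq_tr, Sp.toTD_eq_inner, toLpLI_apply]
  rw [h]
  exact continuous_const.inner ((toLpLI d (-p)).continuous.comp (continuous_embed_tr _ _))

/-- Polynomial growth of `φ * p_t`, uniformly in `φ` in the unit ball of `𝓢_p`. -/
theorem exists_abs_convHeat_le {t : ℝ} (ht : 0 < t) (p : ℝ) :
    ∃ (C : ℝ) (m : ℕ), 0 ≤ C ∧ ∀ (u : Sp d p) x,
      |convHeat u.toTD t ht x| ≤ ‖u‖ * (C * (1 + ‖x‖) ^ m) := by
  obtain ⟨C, m, hC, h⟩ := exists_norm_clm_tr_le (embed (-p)) (heatKernelS (d := d) t ht 0)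
  refine ⟨C, m, hC, fun u x => ?_⟩
  rw [convHeat, heatKernelS_eq_tr]
  exact (u.abs_toTD_le _).trans (by gcongr; exact h x)

theorem integrable_convHeat_mul {t : ℝ} (ht : 0 < t) (u : Sp d p) (f : 𝓢(Euc d, ℝ)) :
    Integrable fun x => convHeat u.toTD t ht x * f x := by
  obtain ⟨C, m, hC, h⟩ := exists_abs_convHeat_le (d := d) ht p
  refine ((integrable_one_add_norm_pow_mul m f).const_mul (‖u‖ * C)).mono'
    ((continuous_convHeat ht u).mul f.continuous).aestronglyMeasurable (Eventually.of_forall fun x => ?_)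
  rw [norm_mul, Real.norm_eq_abs, Real.norm_eq_abs]
  calc |convHeat u.toTD t ht x| * |f x| ≤ ‖u‖ * (C * (1 + ‖x‖) ^ m) * |f x| := by
        gcongr; exact h u x
    _ = _ := by ring

theorem continuous_integral_convHeat_mul {t : ℝ} (ht : 0 < t) (p : ℝ) (f : 𝓢(Euc d, ℝ)) :
    Continuous fun u : Sp d p => ∫ x, convHeat u.toTD t ht x * f x := by
  obtain ⟨C, m, hC, h⟩ := exists_abs_convHeat_le (d := d) ht p
  refine (LinearMap.mkContinuous
    { toFun := fun u : Sp d p => ∫ x, convHeat u.toTD t ht x * f x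
      map_add' := fun u v => by
        rw [← integral_add (integrable_convHeat_mul ht u f) (integrable_convHeat_mul ht v f)]
        simp only [convHeat, map_add, add_apply, add_mul]
      map_smul' := fun c u => by
        rw [RingHom.id_apply, smul_eq_mul, ← integral_const_mul]
        simp only [convHeat, map_smul, smul_apply, smul_eq_mul, mul_assoc] }
    (C * ∫ x : Euc d, (1 + ‖x‖) ^ m * |f x|) fun u => ?_).continuous
  refine (norm_integral_le_of_norm_le ((integrable_one_add_norm_pow_mul m f).const_mul (‖u‖ * C))
    (Eventually.of_forall fun x => ?_)).trans (le_of_eq ?_)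
  · rw [norm_mul, Real.norm_eq_abs, Real.norm_eq_abs]
    calc |convHeat u.toTD t ht x| * |f x| ≤ ‖u‖ * (C * (1 + ‖x‖) ^ m) * |f x| := by
          gcongr; exact h u x
      _ = _ := by ring
  · rw [integral_const_mul]; ring

/-- The heat operator is the convolution with the heat kernel: both sides are continuous in
`φ ∈ 𝓢_p`, and they agree on Schwartz functions by Fubini's theorem. -/
theorem isGivenBy_gaussAvg {t : ℝ} (ht : 0 < t) (u : Sp d p) :
    IsGivenBy (gaussAvg d p (Real.sqrt t) u).toTD (convHeat u.toTD t ht) := by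
  refine fun f => ⟨integrable_convHeat_mul ht u f, ?_⟩
  have h1 : Continuous fun u : Sp d p => (gaussAvg d p (Real.sqrt t) u).toTD f :=
    (evalCLM p f).continuous.comp (gaussAvg d p (Real.sqrt t)).continuous
  refine congrFun (denseRange_embed.equalizer h1 (continuous_integral_convHeat_mul ht p f)
    (funext fun g => ?_)) u
  simp only [Function.comp_apply]
  rw [toTD_gaussAvg_sqrt ht]
  simp only [convHeat, toTD_shift_apply, toTD_embed_apply, tr_apply, heatKernelS_apply, sub_neg_eq_add]
  exact integral_heatKernel_swap ht g f

end

section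

open LineDeriv Laplacian

variable {d : ℕ}

/-! ### The heat equation -/

theorem hasLineDerivAt_heatKernel_one (z : Euc d) (j : Fin d) :
    HasLineDerivAt ℝ (heatKernel 1 : Euc d → ℝ) (-(z j * heatKernel 1 z)) z (basisVec j) := by
  have h1 : HasFDerivAt (fun x : Euc d => -(‖x‖ ^ 2 / (2 * 1)))
      (-((2 * 1 : ℝ)⁻¹ • (2 • innerSL ℝ z))) z := by
    have := ((hasStrictFDerivAt_norm_sq z).hasFDerivAt.mul_const ((2 * 1 : ℝ)⁻¹)).neg
    simp only [div_eq_mul_inv]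
    exact this
  have h2 := (h1.exp.const_mul (1 / (2 * Real.pi * 1) ^ ((d : ℝ) / 2))).hasLineDerivAt (basisVec j)
  convert! h2 using 1
  simp [heatKernel, basisVec, EuclideanSpace.inner_single_right]
  ring

variable [NeZero d] {p : ℝ}

theorem hasDerivAt_toTD_shift (u : Sp d p) (f : 𝓢(Euc d, ℝ)) (x v : Euc d) (t : ℝ) :
    HasDerivAt (fun t : ℝ => (shift d p (x + t • v) u).toTD f)
      ((shift d p (x + t • v) u).toTD (∂_{v} f)) t := by
  have e : ∀ (t : ℝ) (f : 𝓢(Euc d, ℝ)), (shift d p (x + t • v) u).toTD f =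
      innerSL ℝ u.toLp (toLpLI d (-p) (embed (-p) (tr (-x + t • (-v)) f))) := by
    intro t f
    rw [toTD_shift_apply, Sp.toTD_eq_inner, neg_add, smul_neg]
    rfl
  simp only [e]
  have h := ((innerSL ℝ u.toLp).hasFDerivAt.comp_hasDerivAt t
    ((toLpLI d (-p)).toContinuousLinearMap.hasFDerivAt.comp_hasDerivAt t
      (hasDerivAt_embed_tr (-p) (-x) (-v) f t)))
  simp only [lineDerivOp_left_neg, map_neg, neg_neg] at h
  exact h

theorem continuous_toTD_shift (u : Sp d p) (f : 𝓢(Euc d, ℝ)) :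
    Continuous fun x => (shift d p x u).toTD f :=
  (evalCLM p f).continuous.comp (continuous_shift u)

theorem abs_toTD_shift_le (u : Sp d p) (f : 𝓢(Euc d, ℝ)) (x : Euc d) :
    |(shift d p x u).toTD f| ≤ Real.exp (shiftRate d p * ‖x‖) * (‖u‖ * ‖embed (-p) f‖) := by
  refine (Sp.abs_toTD_le _ f).trans ?_
  rw [← mul_assoc]
  gcongr
  exact norm_shift_apply_le x u

/-- A bound uniform for `|a| ≤ R`; the factor `z_j` is absorbed into the exponential. -/
theorem norm_coord_mul_heatKernel_mul_le (u : Sp d p) (f : 𝓢(Euc d, ℝ)) {a R : ℝ} (ha : |a| ≤ R)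
    (z : Euc d) (j : Fin d) :
    ‖heatKernel 1 z * (z j * (shift d p (a • z) u).toTD f)‖ ≤
      heatKernel 1 z * Real.exp ((1 + shiftRate d p * R) * ‖z‖) * (‖u‖ * ‖embed (-p) f‖) := by
  have hk := heatKernel_nonneg one_pos z
  have hz : |z j| ≤ Real.exp ‖z‖ :=
    (PiLp.norm_apply_le z j).trans (by linarith [Real.add_one_le_exp ‖z‖])
  have h1 := abs_toTD_shift_le u f (a • z)
  have hr := shiftRate_nonneg (d := d) (p := p)
  have h2 : shiftRate d p * ‖a • z‖ ≤ shiftRate d p * R * ‖z‖ := by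
    rw [norm_smul, Real.norm_eq_abs, mul_assoc]
    gcongr
  rw [norm_mul, Real.norm_of_nonneg hk, norm_mul, Real.norm_eq_abs, Real.norm_eq_abs, mul_assoc]
  refine mul_le_mul_of_nonneg_left ?_ hk
  calc |z j| * |(shift d p (a • z) u).toTD f|
      ≤ Real.exp ‖z‖ * (Real.exp (shiftRate d p * R * ‖z‖) * (‖u‖ * ‖embed (-p) f‖)) := by
        gcongr
        exact h1.trans (by gcongr)
    _ = _ := by rw [← mul_assoc, ← Real.exp_add]; ring_nf

theorem continuous_coord_mul_heatKernel_mul (u : Sp d p) (f : 𝓢(Euc d, ℝ)) (a : ℝ) (j : Fin d) :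
    Continuous fun z : Euc d => heatKernel 1 z * (z j * (shift d p (a • z) u).toTD f) := by
  have h1 : Continuous fun z : Euc d => (shift d p (a • z) u).toTD f :=
    (continuous_toTD_shift u f).comp (continuous_const_smul a)
  have h2 : Continuous fun z : Euc d => z j := (EuclideanSpace.proj (𝕜 := ℝ) j).continuous
  exact (continuous_heatKernel 1).mul (h2.mul h1)

theorem integrable_coord_mul_heatKernel_mul (u : Sp d p) (f : 𝓢(Euc d, ℝ)) (a : ℝ) (j : Fin d) :
    Integrable fun z : Euc d => heatKernel 1 z * (z j * (shift d p (a • z) u).toTD f) :=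
  ((integrable_heatKernel_mul_exp _).mul_const _).mono'
    (continuous_coord_mul_heatKernel_mul u f a j).aestronglyMeasurable
    (Eventually.of_forall fun z => norm_coord_mul_heatKernel_mul_le u f le_rfl z j)

theorem integrable_heatKernel_mul_toTD (u : Sp d p) (f : 𝓢(Euc d, ℝ)) (a : ℝ) :
    Integrable fun z : Euc d => heatKernel 1 z * (shift d p (a • z) u).toTD f := by
  have h := (evalCLM p f).integrable_comp (integrable_heatKernel_smul_shift a u)
  refine h.congr (Eventually.of_forall fun z => ?_)
  simp

/-- Gaussian integration by parts. -/
theorem integral_coord_mul_heatKernel (u : Sp d p) (f : 𝓢(Euc d, ℝ)) (a : ℝ) (j : Fin d) :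
    ∫ z : Euc d, heatKernel 1 z * (z j * (shift d p (a • z) u).toTD f) =
      a * (gaussAvg d p a u).toTD (∂_{basisVec j} f) := by
  have hd : ∀ z : Euc d, HasLineDerivAt ℝ (fun z => (shift d p (a • z) u).toTD f)
      (a * (shift d p (a • z) u).toTD (∂_{basisVec j} f)) z (basisVec j) := by
    intro z
    have h := hasDerivAt_toTD_shift u f (a • z) (a • basisVec j) 0
    rw [zero_smul, add_zero, lineDerivOp_left_smul, map_smul, smul_eq_mul] at h
    refine h.congr_of_eventuallyEq (Eventually.of_forall fun t => ?_)
    simp only [smul_add, smul_comm t a]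
  have hf'g : Integrable fun z : Euc d => -(z j * heatKernel 1 z) * (shift d p (a • z) u).toTD f := by
    refine (integrable_coord_mul_heatKernel_mul u f a j).neg.congr (Eventually.of_forall fun z => ?_)
    simp only [Pi.neg_apply]
    ring
  have hfg' : Integrable fun z : Euc d => heatKernel 1 z *
      (a * (shift d p (a • z) u).toTD (∂_{basisVec j} f)) := by
    refine ((integrable_heatKernel_mul_toTD u (∂_{basisVec j} f) a).const_mul a).congr
      (Eventually.of_forall fun z => ?_)
    ring
  have h := integral_bilinear_hasLineDerivAt_right_eq_neg_left_of_integrable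
    (μ := (volume : Measure (Euc d))) (B := ContinuousLinearMap.mul ℝ ℝ) hf'g hfg'
    (integrable_heatKernel_mul_toTD u f a) (fun z _ => hasLineDerivAt_heatKernel_one z j)
    (fun z _ => hd z)
  simp only [ContinuousLinearMap.mul_apply'] at h
  rw [toTD_gaussAvg, ← integral_const_mul]
  have e1 : ∫ z : Euc d, a * (heatKernel 1 z * (shift d p (a • z) u).toTD (∂_{basisVec j} f)) =
      ∫ z : Euc d, heatKernel 1 z * (a * (shift d p (a • z) u).toTD (∂_{basisVec j} f)) := by
    congr 1; ext z; ring
  rw [e1, h, ← integral_neg]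
  congr 1; ext z; ring

/-- The heat equation in terms of the standard deviation `a = √t`. -/
theorem hasDerivAt_toTD_gaussAvg (u : Sp d p) (f : 𝓢(Euc d, ℝ)) (a : ℝ) :
    HasDerivAt (fun a : ℝ => (gaussAvg d p a u).toTD f) (a * (gaussAvg d p a u).toTD (Δ f)) a := by
  have hz : ∀ (z : Euc d) (b : ℝ), HasDerivAt (fun b : ℝ => heatKernel 1 z * (shift d p (b • z) u).toTD f)
      (∑ j, heatKernel 1 z * (z j * (shift d p (b • z) u).toTD (∂_{basisVec j} f))) b := by
    intro z b
    have h := (hasDerivAt_toTD_shift u f 0 z b).const_mul (heatKernel 1 z)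
    simp only [zero_add] at h
    rw [lineDeriv_eq_sum, map_sum, Finset.mul_sum] at h
    simpa only [map_smul, smul_eq_mul] using h
  have h := (hasDerivAt_integral_of_dominated_loc_of_deriv_le (μ := (volume : Measure (Euc d)))
    (s := Metric.ball a 1) (x₀ := a)
    (F := fun b z => heatKernel 1 z * (shift d p (b • z) u).toTD f)
    (F' := fun b z => ∑ j, heatKernel 1 z * (z j * (shift d p (b • z) u).toTD (∂_{basisVec j} f)))
    (bound := fun z => ∑ j : Fin d, heatKernel 1 z *
      Real.exp ((1 + shiftRate d p * (|a| + 1)) * ‖z‖) * (‖u‖ * ‖embed (-p) (∂_{basisVec j} f)‖))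
    (Metric.ball_mem_nhds a one_pos)
    (Eventually.of_forall fun b => (integrable_heatKernel_mul_toTD u f b).1)
    (integrable_heatKernel_mul_toTD u f a)
    (continuous_finsetSum _ fun j _ =>
      continuous_coord_mul_heatKernel_mul u _ a j).aestronglyMeasurable
    (Eventually.of_forall fun z b hb => by
      refine (norm_sum_le _ _).trans (Finset.sum_le_sum fun j _ => ?_)
      refine norm_coord_mul_heatKernel_mul_le u _ ?_ z j
      have := abs_add_le a (b - a)
      rw [add_sub_cancel] at this
      rw [Metric.mem_ball, Real.dist_eq] at hb
      linarith)
    (integrable_finsetSum _ fun j _ => (integrable_heatKernel_mul_exp _).mul_const _)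
    (Eventually.of_forall fun z b _ => hz z b)).2
  simp only [← toTD_gaussAvg] at h
  rw [integral_finsetSum _ fun j _ => integrable_coord_mul_heatKernel_mul u _ a j] at h
  simp only [integral_coord_mul_heatKernel] at h
  rw [← Finset.mul_sum, ← map_sum, ← laplacian_eq_sum_basisVec] at h
  exact h

theorem toTD_gaussAvg_sqrt_eq_add_integral (u : Sp d p) (f : 𝓢(Euc d, ℝ)) {t : ℝ} (ht : 0 ≤ t) :
    (gaussAvg d p (Real.sqrt t) u).toTD f =
      u.toTD f + ∫ s in (0 : ℝ)..t, (1 / 2 : ℝ) * (gaussAvg d p (Real.sqrt s) u).toTD (Δ f) := by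
  have hc : ∀ f : 𝓢(Euc d, ℝ), Continuous fun s : ℝ => (gaussAvg d p (Real.sqrt s) u).toTD f :=
    fun f => (evalCLM p f).continuous.comp ((continuous_gaussAvg u).comp Real.continuous_sqrt)
  have h := intervalIntegral.integral_eq_sub_of_hasDerivAt_of_le ht (hc f).continuousOn
    (f' := fun s => (1 / 2 : ℝ) * (gaussAvg d p (Real.sqrt s) u).toTD (Δ f)) (fun s hs => by
      have h1 := (hasDerivAt_toTD_gaussAvg u f (Real.sqrt s)).comp s
        (Real.hasDerivAt_sqrt hs.1.ne')
      convert! h1 using 1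
      have : Real.sqrt s ≠ 0 := (Real.sqrt_pos.2 hs.1).ne'
      field_simp)
    (((hc (Δ f)).const_mul _).intervalIntegrable 0 t)
  rw [h, Real.sqrt_zero, gaussAvg_zero]
  ring

theorem isHeatSolution_gaussAvg (T : ℝ) (u : Sp d p) :
    IsHeatSolution T u fun t => gaussAvg d p (Real.sqrt t) u := by
  obtain ⟨Λ, -, hΛ⟩ := exists_laplacian d p
  have hc : Continuous fun t : ℝ => gaussAvg d p (Real.sqrt t) u :=
    (continuous_gaussAvg u).comp Real.continuous_sqrt
  have hi : ∀ t : ℝ, IntervalIntegrable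
      (fun s : ℝ => (1 / 2 : ℝ) • Λ (gaussAvg d p (Real.sqrt s) u)) volume 0 t := fun t =>
    ((Λ.continuous.comp hc).const_smul (1 / 2 : ℝ)).intervalIntegrable 0 t
  refine ⟨hc.continuousOn, fun s => Λ (gaussAvg d p (Real.sqrt s) u), fun s _ => hΛ _,
    fun t ht => ⟨hi t, ?_⟩⟩
  ext f
  rw [toTD_gaussAvg_sqrt_eq_add_integral u f ht.1, add_apply, ← evalCLM_apply (p := p - 1) f,
    ← ContinuousLinearMap.intervalIntegral_comp_comm _ (hi t)]
  congr 2
  funext s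
  rw [map_smul, evalCLM_apply, hΛ]
  rfl

/-! ### Uniqueness -/

/-- The monotonicity inequality for the Laplacian in `𝓢_{p-1}`, for elements of `𝓢_p`. -/
theorem exists_inner_laplacian_le (J Λ : Sp d p →L[ℝ] Sp d (p - 1))
    (hJ : ∀ f, J (embed p f) = embed (p - 1) f) (hΛ : ∀ f, Λ (embed p f) = embed (p - 1) (Δ f)) :
    ∃ C : ℝ, ∀ u : Sp d p, inner ℝ (J u).toLp (Λ u).toLp ≤ C * ‖J u‖ ^ 2 := by
  obtain ⟨C, -, H⟩ := exists_ip_laplacian_le d (p - 1)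
  refine ⟨C, fun u => ?_⟩
  -- Both sides are continuous on `𝓢_p`, so the case of Schwartz functions suffices.
  have hcl : IsClosed {u : Sp d p | inner ℝ (J u).toLp (Λ u).toLp ≤ C * ‖J u‖ ^ 2} := by
    refine isClosed_le ?_ (continuous_const.mul (J.continuous.norm.pow 2))
    exact Continuous.inner ((toLpLI d (p - 1)).continuous.comp J.continuous)
      ((toLpLI d (p - 1)).continuous.comp Λ.continuous)
  have := hcl.closure_subset_iff.2
    (show Set.range (embed p : 𝓢(Euc d, ℝ) →L[ℝ] Sp d p) ⊆ _ by
      rintro _ ⟨f, rfl⟩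
      simp only [Set.mem_ofPred_eq, hJ, hΛ]
      rw [real_inner_comm]
      exact H f)
  exact this (denseRange_embed u)

/-- Two solutions with the same initial value agree: Grönwall's inequality for the
`𝓢_{p-1}`-norm of their difference. -/
theorem IsHeatSolution.eq {T : ℝ} {u : Sp d p} {ψ₁ ψ₂ : ℝ → Sp d p}
    (h₁ : IsHeatSolution T u ψ₁) (h₂ : IsHeatSolution T u ψ₂) {t : ℝ} (ht : t ∈ Set.Icc 0 T) :
    ψ₁ t = ψ₂ t := by
  obtain ⟨J, hJe, hJ⟩ := exists_inclusion (d := d) (q := p - 1) (p := p) (by linarith)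
  obtain ⟨Λ, hΛe, hΛ⟩ := exists_laplacian d p
  obtain ⟨C, hC⟩ := exists_inner_laplacian_le J Λ hJe hΛe
  obtain ⟨c₁, v₁, hv₁, e₁⟩ := h₁
  obtain ⟨c₂, v₂, hv₂, e₂⟩ := h₂
  have hT : 0 ≤ T := ht.1.trans ht.2
  -- The difference of the solutions, extended continuously to the whole line.
  set D : ℝ → Sp d p := Set.IccExtend hT ((Set.Icc 0 T).domRestrict fun s => ψ₁ s - ψ₂ s) with hD
  have hDc : Continuous D := (continuousOn_iff_continuous_domRestrict.1 (c₁.sub c₂)).Icc_extend'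
  have hDe : ∀ s ∈ Set.Icc 0 T, D s = ψ₁ s - ψ₂ s := fun s hs => by
    rw [hD, Set.IccExtend_of_mem hT _ hs]; rfl
  have hv : ∀ s ∈ Set.Icc 0 T, v₁ s - v₂ s = Λ (D s) := fun s hs => by
    apply Sp.toTD_injective
    rw [hΛ, hDe s hs, map_sub, map_sub, hv₁ s hs, hv₂ s hs]
    exact (ContinuousLinearMap.sub_comp _ _ _).symm
  set I : ℝ → Sp d (p - 1) := fun t => ∫ s in (0 : ℝ)..t, (1 / 2 : ℝ) • Λ (D s) with hI
  have hIc : Continuous fun s : ℝ => (1 / 2 : ℝ) • Λ (D s) :=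
    (Λ.continuous.comp hDc).const_smul (1 / 2 : ℝ)
  have hJD : ∀ t ∈ Set.Icc 0 T, J (D t) = I t := fun t ht => by
    apply Sp.toTD_injective
    have e3 : I t = (∫ s in (0 : ℝ)..t, (1 / 2 : ℝ) • v₁ s) - ∫ s in (0 : ℝ)..t, (1 / 2 : ℝ) • v₂ s := by
      rw [← intervalIntegral.integral_sub (e₁ t ht).1 (e₂ t ht).1]
      refine intervalIntegral.integral_congr fun s hs => ?_
      rw [Set.uIcc_of_le ht.1] at hs
      rw [← smul_sub, hv s ⟨hs.1, hs.2.trans ht.2⟩]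
    rw [hJ, hDe t ht, map_sub, (e₁ t ht).2, (e₂ t ht).2, e3, map_sub]
    abel
  have hId : ∀ t, HasDerivAt I ((1 / 2 : ℝ) • Λ (D t)) t := fun t =>
    intervalIntegral.integral_hasDerivAt_right (hIc.intervalIntegrable 0 t)
      (hIc.stronglyMeasurableAtFilter _ _) hIc.continuousAt
  -- The difference is differentiable only as a map into `𝓢_{p-1}`, hence the norm of that space.
  have hNd : ∀ t, HasDerivAt (fun t => ‖toLpLI d (p - 1) (I t)‖ ^ 2)
      (2 * inner ℝ (toLpLI d (p - 1) (I t)) (toLpLI d (p - 1) ((1 / 2 : ℝ) • Λ (D t)))) t := fun t =>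
    ((toLpLI d (p - 1)).toContinuousLinearMap.hasFDerivAt.comp_hasDerivAt t (hId t)).norm_sq
  have hG := le_mul_exp_of_deriv_le (K := C) ht.1 hNd (fun s hs => by
    have hs' : s ∈ Set.Icc 0 T := ⟨hs.1.le, hs.2.le.trans ht.2⟩
    rw [map_smul, inner_smul_right, LinearIsometry.norm_map, ← hJD s hs']
    have := hC (D s)
    simp only [toLpLI_apply]
    linarith)
  have hI0 : I 0 = 0 := by rw [hI]; exact intervalIntegral.integral_same
  simp only [LinearIsometry.norm_map, hI0, norm_zero] at hG
  have hIt : I t = 0 := by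
    rw [← norm_eq_zero, ← sq_eq_zero_iff]
    refine le_antisymm (hG.trans (by simp)) (sq_nonneg _)
  have h0 : (ψ₁ t - ψ₂ t).toTD = 0 := by
    rw [← hDe t ht, ← hJ, hJD t ht, hIt, map_zero]
  rw [← sub_eq_zero]
  apply Sp.toTD_injective
  rw [h0, map_zero]

/-! ### The Brownian expectation -/

/-- The expectation of `τ_{X_t} φ` depends on the Brownian motion only through the Gaussian law of
`X_t`. -/
theorem IsBrownianMotion.integrable_shift_and_integral_eq {Ω : Type*} {mΩ : MeasurableSpace Ω}
    {P : Measure Ω} [IsProbabilityMeasure P] {ℱ : Filtration ℝ≥0 mΩ} {X : ℝ≥0 → Ω → Euc d}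
    (hX : IsBrownianMotion P ℱ X) (u : Sp d p) (t : ℝ≥0) :
    Integrable (fun ω => shift d p (X t ω) u) P ∧
      ∫ ω, shift d p (X t ω) u ∂P = gaussAvg d p (Real.sqrt t) u := by
  have hm : ∀ t, Measurable (X t) := fun t => (hX.adapted t).mono (ℱ.le t) le_rfl
  rcases eq_or_ne t 0 with rfl | ht
  · have h0 : (fun ω => shift d p (X 0 ω) u) =ᵐ[P] fun _ => u := by
      filter_upwards [hX.start] with ω hω
      rw [hω, shift_zero]
    refine ⟨(integrable_const u).congr h0.symm, ?_⟩
    rw [integral_congr_ae h0, NNReal.coe_zero, Real.sqrt_zero, gaussAvg_zero]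
    simp
  · have ht' : 0 < t := pos_iff_ne_zero.2 ht
    have ht0 : 0 < (t : ℝ) := ht'
    have hlaw : P.map (X t) =
        volume.withDensity fun x : Euc d => ENNReal.ofReal (heatKernel (t : ℝ) x) := by
      have h := hX.law 0 t ht'
      rw [NNReal.coe_zero, sub_zero] at h
      rw [← h]
      refine Measure.map_congr ?_
      filter_upwards [hX.start] with ω hω
      rw [hω, sub_zero]
    have hmk : Measurable fun x : Euc d => ENNReal.ofReal (heatKernel (t : ℝ) x) :=
      (continuous_heatKernel _).measurable.ennreal_ofReal
    have hsm : AEStronglyMeasurable (fun x => shift d p x u) (P.map (X t)) :=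
      (continuous_shift u).aestronglyMeasurable
    have hk : ∀ x : Euc d, (ENNReal.ofReal (heatKernel (t : ℝ) x)).toReal = heatKernel (t : ℝ) x :=
      fun x => ENNReal.toReal_ofReal (heatKernel_nonneg ht0 x)
    constructor
    · refine (integrable_map_measure hsm (hm t).aemeasurable).1 ?_
      rw [hlaw, integrable_withDensity_iff_integrable_smul' hmk (by simp)]
      simp only [hk]
      exact integrable_heatKernel_smul_shift' ht0 u
    · rw [← integral_map (hm t).aemeasurable hsm, hlaw,
        integral_withDensity_eq_integral_toReal_smul hmk (by simp), gaussAvg_sqrt ht0]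
      simp only [hk]

end

end HeatSp

end

theorem theorem2p4 {d : ℕ} [NeZero d] {Ω : Type*} {mΩ : MeasurableSpace Ω}
    (P : Measure Ω) [IsProbabilityMeasure P] (ℱ : Filtration ℝ≥0 mΩ)
    (X : ℝ≥0 → Ω → HeatSp.Euc d) (hX : HeatSp.IsBrownianMotion P ℱ X) (p : ℝ) :
    ∃ (τ : HeatSp.Euc d → HeatSp.Sp d p → HeatSp.Sp d p)
      (Tsg : ℝ≥0 → HeatSp.Sp d p →L[ℝ] HeatSp.Sp d p),
      -- `τ x` is the translation operator on `𝓢_p`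
      (∀ x φ, HeatSp.Sp.toTD (τ x φ) = HeatSp.translate x (HeatSp.Sp.toTD φ)) ∧
      -- `Tsg t` is the heat semigroup: `T_0 φ = φ` and `T_t φ = φ * p_t` for `t > 0`
      (∀ φ, Tsg 0 φ = φ) ∧
      (∀ (t : ℝ≥0) (ht : 0 < (t : ℝ)) (φ : HeatSp.Sp d p),
        HeatSp.IsGivenBy (HeatSp.Sp.toTD (Tsg t φ))
          (HeatSp.convHeat (HeatSp.Sp.toTD φ) t ht)) ∧
      -- (a)
      (∀ (φ : HeatSp.Sp d p) (t : ℝ≥0),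
        Integrable (fun ω => τ (X t ω) φ) P ∧ ∫ ω, τ (X t ω) φ ∂P = Tsg t φ) ∧
      (∀ T : ℝ≥0, 0 < T → ∃ C : ℝ, ∀ t ≤ T, ‖Tsg t‖ ≤ C) ∧
      -- (b)
      (∀ φ : HeatSp.Sp d p,
        (∀ T : ℝ, 0 < T →
          HeatSp.IsHeatSolution T φ (fun t => ∫ ω, τ (X t.toNNReal ω) φ ∂P) ∧
          ∀ ψ : ℝ → HeatSp.Sp d p, HeatSp.IsHeatSolution T φ ψ →
            ∀ t ∈ Set.Icc 0 T, ψ t = ∫ ω, τ (X t.toNNReal ω) φ ∂P) ∧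
        Tendsto (fun t : ℝ≥0 => ∫ ω, τ (X t ω) φ ∂P) (𝓝[>] 0) (𝓝 φ)) := by
  have hE := fun (φ : HeatSp.Sp d p) (t : ℝ≥0) => hX.integrable_shift_and_integral_eq φ t
  have hψ : ∀ φ : HeatSp.Sp d p, (fun t : ℝ => ∫ ω, HeatSp.shift d p (X t.toNNReal ω) φ ∂P) =
      fun t => HeatSp.gaussAvg d p (Real.sqrt t) φ := by
    intro φ
    funext t
    rw [(hE φ t.toNNReal).2, Real.coe_toNNReal']
    rcases le_total 0 t with h | h
    · rw [max_eq_left h]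
    · rw [max_eq_right h, Real.sqrt_zero, Real.sqrt_eq_zero_of_nonpos h]
  refine ⟨fun x φ => HeatSp.shift d p x φ, fun t => HeatSp.gaussAvg d p (Real.sqrt t),
    HeatSp.toTD_shift, fun φ => ?_, fun t ht φ => HeatSp.isGivenBy_gaussAvg ht φ, hE, fun T _ => ?_,
    fun φ => ⟨fun T _ => ⟨?_, fun ψ hψs t ht => ?_⟩, ?_⟩⟩
  · change HeatSp.gaussAvg d p (Real.sqrt ((0 : ℝ≥0) : ℝ)) φ = φ
    rw [NNReal.coe_zero, Real.sqrt_zero, HeatSp.gaussAvg_zero]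
  · refine ⟨HeatSp.gaussMoment d (HeatSp.shiftRate d p * Real.sqrt T), fun t ht => ?_⟩
    refine (HeatSp.norm_gaussAvg_le _).trans (HeatSp.gaussMoment_mono ?_)
    rw [abs_of_nonneg (Real.sqrt_nonneg _)]
    exact mul_le_mul_of_nonneg_left (Real.sqrt_le_sqrt ht) HeatSp.shiftRate_nonneg
  · rw [hψ]
    exact HeatSp.isHeatSolution_gaussAvg T φ
  · rw [congrFun (hψ φ) t]
    exact hψs.eq (HeatSp.isHeatSolution_gaussAvg T φ) ht
  · have hc : Continuous fun t : ℝ≥0 => HeatSp.gaussAvg d p (Real.sqrt t) φ :=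
      (HeatSp.continuous_gaussAvg φ).comp (Real.continuous_sqrt.comp NNReal.continuous_coe)
    have h := (hc.tendsto 0).mono_left (nhdsWithin_le_nhds (s := Set.Ioi 0))
    rw [NNReal.coe_zero, Real.sqrt_zero, HeatSp.gaussAvg_zero] at h
    exact h.congr fun t => (hE φ t).2.symm
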